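/- Theorem 5.3. For an automorphism $\phi$ of a group $G$, let $R(\phi)\in\{1,2,\dots,\infty\}$ be the number of classes of the equivalence relation $x\sim g\,x\,\phi(g^{-1})$ $(g\in G)$ on $G$; the group $G$ has the $R_\infty$ property if $R(\phi)=\infty$ for every automorphism $\phi$ of $G$. For an integer $n\ge 0$ let $B_n(D)$ be the Artin braid group on $n$ strings (the braid group of the disk $D$), i.e. the group with generators $\sigma_1,\dots,\sigma_{n-1}$ and relations $$\sigma_i\sigma_{i+1}\sigma_i=\sigma_{i+1}\sigma_i\sigma_{i+1}\quad(1\le i\le n-2),\qquad \sigma_i\sigma_j=\sigma_j\sigma_i\quad(|i-j|\ge 2),$$ so that $B_0(D)$ and $B_1(D)$ are trivial. Then $B_n(D)$ has the $R_\infty$ property if and only if $n>2$. -/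

import Mathlib

/-- The twisted conjugacy relation of an automorphism `φ` of a group `G`:
`x ∼ g x φ(g⁻¹)` for `g ∈ G`. Its classes are the Reidemeister classes of `φ`. -/
def twistedConj {G : Type*} [Group G] (φ : G ≃* G) : Setoid G where
  r x y := ∃ g : G, y = g * x * φ g⁻¹
  iseqv :=
    { refl := fun x => ⟨1, by simp⟩
      symm := by
        rintro x y ⟨g, rfl⟩
        exact ⟨g⁻¹, by simp [mul_assoc]⟩
      trans := by
        rintro x y z ⟨g, rfl⟩ ⟨h, rfl⟩
        exact ⟨h * g, by simp [mul_assoc]⟩ }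

/-- The Reidemeister number `R(φ)`: the number of Reidemeister classes of `φ`, with value `⊤`
when there are infinitely many. -/
noncomputable def reidemeisterNumber {G : Type*} [Group G] (φ : G ≃* G) : ℕ∞ :=
  ENat.card (Quotient (twistedConj φ))

/-- The property `R_∞`: every automorphism has infinite Reidemeister number. -/
def HasRInfinity (G : Type*) [Group G] : Prop :=
  ∀ φ : G ≃* G, reidemeisterNumber φ = ⊤

/-- The relators of the Artin braid group on `n` strings, on the `n - 1` generators `σ i`,
`i : Fin (n - 1)` (no generators for `n ≤ 1`): the braid relations `σ i σ j σ i = σ j σ i σ j`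
for adjacent indices and the commutations `σ i σ j = σ j σ i` for indices at distance at
least two. -/
def braidRels (n : ℕ) : Set (FreeGroup (Fin (n - 1))) :=
  {r | ∃ i j : Fin (n - 1), (i : ℕ) + 1 = j ∧
      r = FreeGroup.of i * FreeGroup.of j * FreeGroup.of i *
        (FreeGroup.of j * FreeGroup.of i * FreeGroup.of j)⁻¹} ∪
  {r | ∃ i j : Fin (n - 1), (i : ℕ) + 2 ≤ j ∧
      r = FreeGroup.of i * FreeGroup.of j * (FreeGroup.of j * FreeGroup.of i)⁻¹}

/-- The Artin braid group on `n` strings, that is, the braid group of the disk, given by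
Artin's presentation. -/
abbrev BraidGroup (n : ℕ) : Type :=
  PresentedGroup (braidRels n)

/-! The engine is `reidemeisterNumber_eq_top`: let a subgroup `ker π` be preserved by `φ`, and let a
rational additive function `f` on it be fixed by `φ` followed by conjugation by `a`. If `f p ≠ 0`,
the elements `p ^ k * a` fall into infinitely many classes, provided that only finitely many cosets
of `ker π` can relate them. What remains is to find such an `f` for each automorphism. Write the
number of strings as `m + 1`.

For `m ≥ 4` the subgroup is the pure braid group. It is characteristic: by `factorial_le_card` a
finite group containing a nonconstant braid sequence of length `m` has at least `(m + 1)!` elements,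
with involutions in case of equality, so every surjection onto the symmetric group kills the squares
of the generators; and these normally generate the pure braid group
(`mem_normalClosure_of_braidPerm_eq_one`). Hence `φ` acts on the rational first homology of the pure
braid group, whose coordinates are linking numbers. Comparing traces of conjugations on it shows
that generators go to braids inducing transpositions (`isSwap_braidPerm_aut`). After an inner
correction the first generator keeps its transposition, and then `φ` preserves the line of functions
which change sign under that generator and are invariant under those commuting with it
(`IsAlternating.proportional`). It acts there by a sign, and a further conjugation by the first
generator removes a minus sign.

For `m = 2, 3` the exponent sum is preserved or inverted. If preserved, it is itself the required
function. If inverted, additive functions on its kernel form a plane on which conjugation by a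
generator satisfies `T² - T + 1 = 0` (`step_first`, `eq_zero_of_expSum`, `exists_additive_expSum`).
The automorphism acts on this plane by an integral matrix of trace `0` and determinant `-1`, so it
fixes a nonzero vector.

For at most two strings the group is cyclic, and inversion has at most two classes. -/

/-! ### Braid relations and band generators. -/

/-- A sequence whose first `m` terms satisfy the braid relations. -/
structure IsBraidSeq {G : Type*} [Group G] (m : ℕ) (s : ℕ → G) : Prop where
  braid : ∀ i, i + 1 < m → s i * s (i + 1) * s i = s (i + 1) * s i * s (i + 1)
  comm : ∀ i j, i + 2 ≤ j → j < m → s i * s j = s j * s i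

/-- The band generator joining the points `i` and `i + k + 1`. -/
def arc {G : Type*} [Group G] (s : ℕ → G) (i : ℕ) : ℕ → G
  | 0 => s i
  | k + 1 => s (i + k + 1) * arc s i k * (s (i + k + 1))⁻¹

namespace IsBraidSeq

variable {G : Type*} [Group G] {m : ℕ} {s : ℕ → G}

theorem commute (hs : IsBraidSeq m s) {i j : ℕ} (h : i + 2 ≤ j ∨ j + 2 ≤ i) (hi : i < m)
    (hj : j < m) : Commute (s i) (s j) := by
  rcases h with h | h
  · exact hs.comm i j h hj
  · exact (hs.comm j i h hi).symm

theorem map {H : Type*} [Group H] (hs : IsBraidSeq m s) (f : G →* H) :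
    IsBraidSeq m (fun i => f (s i)) where
  braid i hi := by simp only [← map_mul, hs.braid i hi]
  comm i j hij hj := by simp only [← map_mul, hs.comm i j hij hj]

theorem shift (hs : IsBraidSeq (m + 2) s) : IsBraidSeq m (fun i => s (i + 2)) where
  braid i hi := hs.braid (i + 2) (by omega)
  comm i j hij hj := hs.comm (i + 2) (j + 2) (by omega) (by omega)

theorem mono {k : ℕ} (hs : IsBraidSeq m s) (h : k ≤ m) : IsBraidSeq k s where
  braid i hi := hs.braid i (by omega)
  comm i j hij hj := hs.comm i j (by omega) (by omega)

theorem conj_mul_conj (hs : IsBraidSeq m s) {i : ℕ} (hi : i + 1 < m) :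
    (s i)⁻¹ * s (i + 1) * s i = s (i + 1) * s i * (s (i + 1))⁻¹ := by
  rw [eq_mul_inv_iff_mul_eq, mul_assoc, mul_assoc, inv_mul_eq_iff_eq_mul, ← mul_assoc, ← mul_assoc,
    hs.braid i hi]

theorem commute_arc_far (hs : IsBraidSeq m s) {i k p : ℕ} (hk : i + k < m) (hp : p < m)
    (h : p + 1 < i ∨ i + k + 1 < p) : Commute (s p) (arc s i k) := by
  induction k with
  | zero => exact hs.commute (by omega) hp (by omega)
  | succ k ih =>
    have h1 : Commute (s p) (s (i + k + 1)) := hs.commute (by omega) hp (by omega)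
    exact (h1.mul_right (ih (by omega) (by omega))).mul_right h1.inv_right

theorem commute_arc_inside (hs : IsBraidSeq m s) {i k p : ℕ} (hk : i + k < m) (h1 : i < p)
    (h2 : p < i + k) : Commute (s p) (arc s i k) := by
  induction k with
  | zero => omega
  | succ k ih =>
    rcases Nat.lt_or_ge p (i + k) with h | h
    · have h1 : Commute (s p) (s (i + k + 1)) := hs.commute (by omega) (by omega) (by omega)
      exact (h1.mul_right (ih (by omega) h)).mul_right h1.inv_right
    -- Here the braid relation enters: two extensions conjugate `c` by `b * a`, which carries `b` to
    -- `a`, and `b` commutes with `c`.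
    · obtain rfl : p = i + k := by omega
      obtain ⟨k, rfl⟩ : ∃ l, k = l + 1 := ⟨k - 1, by omega⟩
      have hc : Commute (s (i + k + 1 + 1)) (arc s i k) :=
        hs.commute_arc_far (by omega) (by omega) (by omega)
      have hb := hs.braid (i + k + 1) (by omega)
      set a := s (i + k + 1) with ha
      set b := s (i + k + 1 + 1) with hb'
      set c := arc s i k with hc'
      have : arc s i (k + 1 + 1) = b * (a * c * a⁻¹) * b⁻¹ := rfl
      rw [this]
      change a * _ = _ * a
      have e1 : b * (a * c * a⁻¹) * b⁻¹ = (b * a) * c * (b * a)⁻¹ := by group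
      have e2 : a * (b * a) = (b * a) * b := by rw [← mul_assoc, hb]
      have e3 : (b * a)⁻¹ * a = b * (b * a)⁻¹ := by
        rw [inv_mul_eq_iff_eq_mul, ← mul_assoc, ← e2]; group
      rw [e1]
      calc a * (b * a * c * (b * a)⁻¹) = (a * (b * a)) * c * (b * a)⁻¹ := by group
        _ = (b * a) * (b * c) * (b * a)⁻¹ := by rw [e2]; group
        _ = (b * a) * c * (b * (b * a)⁻¹) := by rw [hc.eq]; group
        _ = _ := by rw [← e3]; group

/-- Arcs are built by moving the right end. The left end can be moved as well, because `s i`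
commutes with all later extensions once the first has been handled by `conj_mul_conj`. -/
theorem conj_arc_left (hs : IsBraidSeq m s) {i k : ℕ} (hk : i + k + 1 < m) :
    s i * arc s i (k + 1) * (s i)⁻¹ = arc s (i + 1) k := by
  induction k with
  | zero =>
    change s i * (s (i + 1) * s i * (s (i + 1))⁻¹) * (s i)⁻¹ = s (i + 1)
    rw [← hs.conj_mul_conj (by omega)]; group
  | succ k ih =>
    have hc : Commute (s i) (s (i + (k + 1) + 1)) := hs.commute (by omega) (by omega) (by omega)
    have e : i + 1 + k + 1 = i + (k + 1) + 1 := by omega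
    have e1 : arc s (i + 1) (k + 1) = s (i + (k + 1) + 1) * arc s (i + 1) k *
      (s (i + (k + 1) + 1))⁻¹ := by rw [← e]; rfl
    have e2 : arc s i (k + 1 + 1) = s (i + (k + 1) + 1) * arc s i (k + 1) *
      (s (i + (k + 1) + 1))⁻¹ := rfl
    rw [e1, e2, ← ih (by omega)]
    have h1 := hc.eq
    set x := s (i + (k + 1) + 1)
    calc s i * (x * arc s i (k + 1) * x⁻¹) * (s i)⁻¹
        = (s i * x) * arc s i (k + 1) * (s i * x)⁻¹ := by group
      _ = _ := by rw [h1]; group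

theorem conj_arc_right (i k : ℕ) :
    s (i + k + 1) * arc s i k * (s (i + k + 1))⁻¹ = arc s i (k + 1) := rfl

/-! ### Noncommutation at the boundary of an arc -/

/-- If `ab = ba`, the relation `aba = bab` cancels to `a = b`. Thus distinct neighbours never
commute, which is the source of every noncommutation below. -/
theorem eq_of_commute (hs : IsBraidSeq m s) {i : ℕ} (hi : i + 1 < m)
    (h : Commute (s i) (s (i + 1))) : s i = s (i + 1) := by
  have := hs.braid i hi
  rw [mul_assoc, ← h.eq, ← mul_assoc] at this
  have h2 : s i * s i * s (i + 1) = s i * s (i + 1) * s (i + 1) := by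
    rw [mul_assoc, h.eq, ← mul_assoc, ← h.eq] at *
    exact this
  exact mul_left_cancel (mul_right_cancel h2)

/-- Terms at distance two commute, so an equality of neighbours makes the adjacent pair commute and
therefore coincide. -/
theorem eq_succ_of_eq (hs : IsBraidSeq m s) {i : ℕ} (hi : i + 2 < m) :
    s i = s (i + 1) ↔ s (i + 1) = s (i + 2) := by
  have h1 := hs.braid i (by omega)
  have h2 := hs.braid (i + 1) (by omega)
  have h3 := hs.comm i (i + 2) le_rfl hi
  constructor
  · intro h
    refine hs.eq_of_commute (by omega) ?_
    rw [← h]; exact h3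
  · intro h
    refine hs.eq_of_commute (by omega) ?_
    rw [h]; exact h3

theorem ne_succ (hs : IsBraidSeq m s) (h01 : s 0 ≠ s 1) {i : ℕ} (hi : i + 1 < m) :
    s i ≠ s (i + 1) := by
  induction i with
  | zero => exact h01
  | succ i ih => exact fun h => ih (by omega) ((hs.eq_succ_of_eq (by omega)).2 h)

theorem not_commute_succ (hs : IsBraidSeq m s) (h01 : s 0 ≠ s 1) {i : ℕ} (hi : i + 1 < m) :
    ¬ Commute (s i) (s (i + 1)) :=
  fun h => hs.ne_succ h01 hi (hs.eq_of_commute hi h)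

theorem commute_conj_iff {g x y : G} : Commute (g * x * g⁻¹) (g * y * g⁻¹) ↔ Commute x y := by
  simp

theorem commute_right_iff (hs : IsBraidSeq m s) {i k : ℕ} (hk : i + k + 1 < m) :
    Commute (s (i + k + 1)) (arc s i k) ↔ Commute (s i) (s (i + 1)) := by
  induction k with
  | zero => exact ⟨fun h => h.symm, fun h => h.symm⟩
  | succ k ih =>
    rw [← ih (by omega)]
    have hc : Commute (s (i + k + 1 + 1)) (arc s i k) :=
      hs.commute_arc_far (by omega) (by omega) (by omega)
    have hb := hs.conj_mul_conj (i := i + k + 1) (by omega)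
    change Commute (s (i + k + 1 + 1)) (s (i + k + 1) * arc s i k * (s (i + k + 1))⁻¹) ↔ _
    set a := s (i + k + 1)
    set b := s (i + k + 1 + 1)
    set c := arc s i k
    -- Conjugating one pair by `b` and the other by `a⁻¹` gives the same pair, since `a⁻¹ b a = b a
    -- b⁻¹` and `b` commutes with `c`.
    rw [← commute_conj_iff (g := b) (x := a), ← commute_conj_iff (g := a⁻¹)]
    have e1 : a⁻¹ * b * a⁻¹⁻¹ = b * a * b⁻¹ := by rw [inv_inv, hb]
    have e2 : a⁻¹ * (a * c * a⁻¹) * a⁻¹⁻¹ = b * c * b⁻¹ := by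
      rw [hc.eq]; group
    rw [e1, e2]

theorem commute_left_iff (hs : IsBraidSeq m s) {i k : ℕ} (hk : i + 1 + k < m) :
    Commute (s i) (arc s (i + 1) k) ↔ Commute (s i) (s (i + 1)) := by
  induction k with
  | zero => rfl
  | succ k ih =>
    rw [← ih (by omega)]
    have hc : Commute (s i) (s (i + 1 + k + 1)) := hs.commute (by omega) (by omega) (by omega)
    change Commute (s i) (s (i + 1 + k + 1) * arc s (i + 1) k * (s (i + 1 + k + 1))⁻¹) ↔ _
    nth_rw 1 [← commute_conj_iff (g := (s (i + 1 + k + 1))) (y := arc s (i + 1) k)]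
    rw [show s (i + 1 + k + 1) * s i * (s (i + 1 + k + 1))⁻¹ = s i by rw [← hc.eq]; group]

/-- The term `s p` commutes with an arc exactly when it meets the ends of the arc in zero or
two points. -/
theorem commute_arc_iff (hs : IsBraidSeq m s) (h01 : s 0 ≠ s 1) {i j p : ℕ} (hij : i < j)
    (hj : j ≤ m) (hp : p < m) :
    Commute (s p) (arc s i (j - i - 1)) ↔ ((p = i ∨ p = j) ↔ (p + 1 = i ∨ p + 1 = j)) := by
  obtain ⟨k, rfl⟩ : ∃ k, j = i + k + 1 := ⟨j - i - 1, by omega⟩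
  rw [show i + k + 1 - i - 1 = k by omega]
  by_cases h1 : p + 1 < i ∨ i + k + 1 < p
  · exact iff_of_true (hs.commute_arc_far (by omega) hp h1) (by omega)
  by_cases h2 : i < p ∧ p < i + k
  · exact iff_of_true (hs.commute_arc_inside (by omega) h2.1 h2.2) (by omega)
  by_cases h3 : p = i + k + 1
  · subst h3
    refine iff_of_false (fun h => ?_) (by omega)
    exact hs.not_commute_succ h01 (by omega) ((hs.commute_right_iff hp).1 h)
  by_cases h4 : p + 1 = i
  · subst h4
    refine iff_of_false (fun h => ?_) (by omega)
    exact hs.not_commute_succ h01 (by omega) ((hs.commute_left_iff (by omega)).1 h)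
  rcases k with _ | k
  · obtain rfl : p = i := by omega
    exact iff_of_true (Commute.refl _) (by omega)
  by_cases h5 : p = i
  · subst h5
    refine iff_of_false (fun h => ?_) (by omega)
    refine hs.not_commute_succ h01 (i := p) (by omega) ((hs.commute_left_iff (k := k) (by omega)).1 ?_)
    rw [← hs.conj_arc_left (by omega), h.eq]
    simpa using h
  · obtain rfl : p = i + k + 1 := by omega
    refine iff_of_false (fun h => ?_) (by omega)
    refine hs.not_commute_succ h01 (i := i) (by omega) ((hs.commute_right_iff (k := k) (by omega)).1 ?_)
    have := h
    rw [← conj_arc_right] at this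
    have h' := (commute_conj_iff (g := (s (i + k + 1))⁻¹)).2 this
    simpa [mul_assoc] using h'

/-- The terms commuting with an arc determine its pair of ends up to complement among the `m + 1`
points. The complement of a pair is again a pair only on four points, which is why `m = 3` is
excluded. -/
theorem arc_injective (hs : IsBraidSeq m s) (h01 : s 0 ≠ s 1) (hm : m = 2 ∨ 4 ≤ m)
    {i j i' j' : ℕ} (hij : i < j) (hj : j ≤ m) (hij' : i' < j') (hj' : j' ≤ m)
    (h : arc s i (j - i - 1) = arc s i' (j' - i' - 1)) : i = i' ∧ j = j' := by
  have key : ∀ p, p < m → (((p = i ∨ p = j) ↔ (p + 1 = i ∨ p + 1 = j)) ↔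
      ((p = i' ∨ p = j') ↔ (p + 1 = i' ∨ p + 1 = j'))) := fun p hp => by
    rw [← hs.commute_arc_iff h01 hij hj hp, ← hs.commute_arc_iff h01 hij' hj' hp, h]
  have a1 := key i
  have a2 := key (j - 1)
  have a3 := key j
  have a4 := key (i - 1)
  have b1 := key i'
  have b2 := key (j' - 1)
  have b3 := key j'
  have b4 := key (i' - 1)
  clear key h
  omega

/-- Every arc is a conjugate of its first generator by an element of the group generated by the
generators under it. -/
theorem exists_conj_arc (i k : ℕ) (K : Subgroup G) (hK : ∀ p, i ≤ p → p ≤ i + k → s p ∈ K) :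
    ∃ g ∈ K, arc s i k = g * s i * g⁻¹ := by
  induction k with
  | zero => exact ⟨1, K.one_mem, by simp [arc]⟩
  | succ k ih =>
    obtain ⟨g, hg, h⟩ := ih fun p h1 h2 => hK p h1 (by omega)
    refine ⟨s (i + k + 1) * g, K.mul_mem (hK _ (by omega) (by omega)) hg, ?_⟩
    rw [← conj_arc_right, h]; group

theorem exists_conj_term (hs : IsBraidSeq m s) {i : ℕ} (hi : i < m) (K : Subgroup G)
    (hK : ∀ p, p ≤ i → s p ∈ K) : ∃ g ∈ K, s i = g * s 0 * g⁻¹ := by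
  induction i with
  | zero => exact ⟨1, K.one_mem, by simp⟩
  | succ i ih =>
    obtain ⟨g, hg, h⟩ := ih (by omega) fun p hp => hK p (by omega)
    -- By the braid relation, `s i * s (i + 1)` conjugates `s i` to `s (i + 1)`.
    refine ⟨s i * s (i + 1) * g, K.mul_mem (K.mul_mem (hK _ (by omega)) (hK _ le_rfl)) hg, ?_⟩
    have := hs.braid i hi
    have h' : s i * g = g * s 0 := eq_mul_inv_iff_mul_eq.1 h
    rw [eq_mul_inv_iff_mul_eq, ← mul_assoc, ← mul_assoc, ← this]
    simp only [mul_assoc, h']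

end IsBraidSeq

/-! ### Lower bounds for finite groups containing a braid sequence. -/

/-- Elements conjugating `x` to different `y i` lie in different left cosets of `C`, since `C`
centralizes `x`. -/
theorem card_mul_card_le_of_conj {G : Type*} [Group G] [Finite G] {ι : Type*} (K C : Subgroup G)
    (hC : C ≤ K) (x : G) (hx : ∀ c ∈ C, Commute c x) (y : ι → G) (hy : Function.Injective y)
    (h : ∀ i, ∃ g ∈ K, y i = g * x * g⁻¹) : Nat.card ι * Nat.card C ≤ Nat.card K := by
  choose g hg hgy using h
  rw [← Nat.card_prod]
  refine Nat.card_le_card_of_injective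
    (fun p : ι × C => (⟨g p.1 * p.2, K.mul_mem (hg _) (hC p.2.2)⟩ : K)) ?_
  rintro ⟨i, c, hc⟩ ⟨j, d, hd⟩ hij
  have e : g i * c = g j * d := congrArg Subtype.val hij
  have key : ∀ i c, c ∈ C → y i = (g i * c) * x * (g i * c)⁻¹ := by
    intro i c hc
    have : g i * c * x * (g i * c)⁻¹ = g i * (c * x) * c⁻¹ * (g i)⁻¹ := by group
    rw [this, (hx c hc).eq, hgy]; group
  obtain rfl : i = j := hy (by rw [key i c hc, key j d hd, e])
  have : c = d := mul_left_cancel e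
  subst this
  rfl

theorem card_sigma_fin_mul_two (n : ℕ) : Nat.card (Σ j : Fin n, Fin j) * 2 = n * (n - 1) := by
  rw [Nat.card_eq_fintype_card, Fintype.card_sigma]
  simp only [Fintype.card_fin]
  rw [Fin.sum_univ_eq_sum_range (fun i => i), Finset.sum_range_id_mul_two]

theorem two_mul_card_le_of_lt {G : Type*} [Group G] [Finite G] {H K : Subgroup G} (h : H < K) :
    2 * Nat.card H ≤ Nat.card K := by
  obtain ⟨c, hc⟩ := Subgroup.card_dvd_of_le h.le
  have : Nat.card K ≠ Nat.card H := fun e => h.ne (Subgroup.eq_of_le_of_card_ge h.le e.le)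
  have hK : 0 < Nat.card K := Nat.card_pos
  rcases c with _ | _ | c
  · omega
  · omega
  · rw [hc, mul_comm]; gcongr; omega

namespace IsBraidSeq

/-- The `(m + 1) * m / 2` arcs are distinct conjugates of `s 0`, so the index of any subgroup
centralizing `s 0` is at least that number. -/
theorem card_class_mul_le {G : Type*} [Group G] [Finite G] {m : ℕ} {s : ℕ → G}
    (hs : IsBraidSeq m s) (h01 : s 0 ≠ s 1) (hm : m = 2 ∨ 4 ≤ m) (C : Subgroup G)
    (hC : ∀ c ∈ C, Commute c (s 0)) : (m + 1) * m * Nat.card C ≤ 2 * Nat.card G := by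
  have := card_mul_card_le_of_conj (ι := Σ j : Fin (m + 1), Fin j) ⊤ C le_top (s 0) hC
    (fun p => arc s p.2 (p.1 - p.2 - 1)) ?_ ?_
  · have h2 := card_sigma_fin_mul_two (m + 1)
    rw [Nat.add_sub_cancel] at h2
    rw [← h2, Subgroup.card_top] at *
    linarith
  · rintro ⟨⟨j, hj⟩, ⟨i, hi⟩⟩ ⟨⟨j', hj'⟩, ⟨i', hi'⟩⟩ h
    obtain ⟨rfl, rfl⟩ := hs.arc_injective h01 hm hi (by omega) hi' (by omega) h
    rfl
  · rintro ⟨⟨j, hj⟩, ⟨i, hi⟩⟩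
    obtain ⟨g, -, hg⟩ := exists_conj_arc (s := s) i (j - i - 1) ⊤ (by simp)
    have hi' : i < j := hi
    obtain ⟨k, -, hk⟩ := hs.exists_conj_term (i := i) (by omega) ⊤ (by simp)
    refine ⟨g * k, trivial, ?_⟩
    change arc s i (j - i - 1) = _
    rw [hg, hk]; group

/-- The terms from `s 2` on form a braid sequence of length `m` centralizing `s 0`. Induction on the
group `H` they generate gives the factor `(m + 1)!`, and `s 0` contributes a factor `2` to a
subgroup centralizing it. The class of `s 0` supplies the remaining `(m + 3) * (m + 2) / 2`. -/
theorem factorial_le_card_step.{u} {m : ℕ} (hm : m = 2 ∨ 4 ≤ m) {G : Type u} [Group G] [Finite G]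
    (ih : ∀ (H : Type u) [Group H] [Finite H] (s : ℕ → H), IsBraidSeq m s → s 0 ≠ s 1 →
      (m + 1).factorial ≤ Nat.card H ∧ (Nat.card H ≤ (m + 1).factorial → s 0 ^ 2 = 1))
    (s : ℕ → G) (hs : IsBraidSeq (m + 2) s) (h01 : s 0 ≠ s 1) :
    (m + 3).factorial ≤ Nat.card G ∧ (Nat.card G ≤ (m + 3).factorial → s 0 ^ 2 = 1) := by
  set k : Set G := {x | ∃ i < m, s (i + 2) = x} with hk
  set H := Subgroup.closure k with hH
  have hkm : ∀ i < m, s (i + 2) ∈ H := fun i hi => Subgroup.subset_closure ⟨i, hi, rfl⟩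
  have hH0 : ∀ c ∈ H, Commute c (s 0) := by
    intro c hc
    have : H ≤ Subgroup.centralizer {s 0} := by
      rw [hH, Subgroup.closure_le]
      rintro _ ⟨i, hi, rfl⟩
      rw [SetLike.mem_coe, Subgroup.mem_centralizer_singleton_iff]
      exact (hs.comm 0 (i + 2) (by omega) (by omega)).symm
    exact (Subgroup.mem_centralizer_singleton_iff.1 (this hc))
  set t : ℕ → H := fun i => if h : i < m then ⟨s (i + 2), hkm i h⟩ else 1 with ht
  have htv : ∀ i < m, (t i : G) = s (i + 2) := fun i hi => by simp [ht, hi]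
  have htb : IsBraidSeq m t :=
    { braid := fun i hi => Subtype.ext (by
        simpa [htv _ hi, htv i (by omega)] using hs.braid (i + 2) (by omega))
      comm := fun i j hij hj => Subtype.ext (by
        simpa [htv _ hj, htv i (by omega)] using hs.comm (i + 2) (j + 2) (by omega) (by omega)) }
  have ht01 : t 0 ≠ t 1 := fun h => hs.ne_succ h01 (i := 2) (by omega) (by
    rw [← htv 0 (by omega), ← htv 1 (by omega), h])
  have hfac : (m + 3).factorial = (m + 3) * (m + 2) * (m + 1).factorial := by
    rw [Nat.factorial_succ, Nat.factorial_succ, mul_assoc]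
  have main : ∃ C : Subgroup G, (∀ c ∈ C, Commute c (s 0)) ∧ 2 * (m + 1).factorial ≤ Nat.card C ∧
      (Nat.card C ≤ 2 * (m + 1).factorial → s 0 ^ 2 = 1) := by
    -- If `s 0` lies in `H` it is central there, so the factor `2` comes from the centre and the
    -- induction applies to the central quotient. Otherwise adjoining `s 0` at least doubles `H`.
    by_cases h0 : s 0 ∈ H
    · refine ⟨H, hH0, ?_⟩
      have hz : (⟨s 0, h0⟩ : H) ∈ Subgroup.center H := by
        rw [Subgroup.mem_center_iff]
        rintro ⟨c, hc⟩
        exact Subtype.ext (hH0 c hc).eq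
      have hZ2 : 2 ≤ Nat.card (Subgroup.center H) := by
        rw [Nat.succ_le_iff, Subgroup.one_lt_card_iff_ne_bot]
        intro hb
        rw [hb, Subgroup.mem_bot] at hz
        have h1 : s 0 = 1 := congrArg Subtype.val hz
        have := hs.braid 0 (by omega)
        rw [h1] at this
        simp only [one_mul, mul_one] at this
        exact h01 (by rw [h1]; exact mul_left_cancel (a := s (0 + 1)) (by simpa using this))
      have hq := ih (H ⧸ Subgroup.center H) (fun i => QuotientGroup.mk' (Subgroup.center H) (t i))
        (htb.map _) ?_
      · have hc := Subgroup.card_eq_card_quotient_mul_card_subgroup (Subgroup.center H)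
        refine ⟨?_, fun hle => ?_⟩
        · rw [hc, mul_comm]
          exact Nat.mul_le_mul hq.1 hZ2
        · have hp : 0 < (m + 1).factorial := Nat.factorial_pos _
          have h2 : Nat.card (Subgroup.center H) = 2 := by
            refine le_antisymm ?_ hZ2
            have : (m + 1).factorial * Nat.card (Subgroup.center H) ≤ (m + 1).factorial * 2 := by
              calc _ ≤ _ := Nat.mul_le_mul_right _ hq.1
                _ ≤ _ := by rw [← hc]; omega
            exact Nat.le_of_mul_le_mul_left this hp
          have := pow_card_eq_one' (x := (⟨⟨s 0, h0⟩, hz⟩ : Subgroup.center H))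
          rw [h2] at this
          exact congrArg (fun x : Subgroup.center H => ((x : H) : G)) this
      · intro h
        -- The first two terms stay distinct modulo the centre: if they differed by a central
        -- element they would commute, hence be equal.
        refine ht01 (htb.eq_of_commute (i := 0) (by omega) ?_)
        have h' : (t 0)⁻¹ * t 1 ∈ Subgroup.center H := QuotientGroup.eq.1 h
        have := Subgroup.mem_center_iff.1 h' (t 0)
        change t 0 * t 1 = t 1 * t 0
        rw [mul_inv_cancel_left] at this
        calc t 0 * t 1 = t 0 * (t 0 * ((t 0)⁻¹ * t 1)) := by group
          _ = t 0 * (t 1) := by group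
          _ = t 1 * t 0 := by
            nth_rw 1 [this]; group
    · have hq := ih H t htb ht01
      refine ⟨H ⊔ Subgroup.zpowers (s 0), ?_, ?_⟩
      · have : H ⊔ Subgroup.zpowers (s 0) ≤ Subgroup.centralizer {s 0} :=
          sup_le (fun c hc => Subgroup.mem_centralizer_singleton_iff.2 (hH0 c hc))
            (by rw [Subgroup.zpowers_le]; exact Subgroup.mem_centralizer_singleton_iff.2 rfl)
        exact fun c hc => Subgroup.mem_centralizer_singleton_iff.1 (this hc)
      · have hlt : H < H ⊔ Subgroup.zpowers (s 0) :=
          lt_of_le_of_ne le_sup_left fun e => h0 (by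
            rw [e]; exact Subgroup.mem_sup_right (Subgroup.mem_zpowers _))
        have h2 := two_mul_card_le_of_lt hlt
        refine ⟨by linarith [hq.1], fun hle => ?_⟩
        have h3 := congrArg Subtype.val (hq.2 (by omega))
        have h4 : s 2 ^ 2 = 1 := by
          rw [← htv 0 (by omega)]; exact h3
        obtain ⟨g, -, hg⟩ := hs.exists_conj_term (i := 2) (by omega) ⊤ (by simp)
        rw [hg, conj_pow] at h4
        simpa using h4
  obtain ⟨C, hC, hC1, hC2⟩ := main
  have hcl := hs.card_class_mul_le h01 (by omega) C hC
  have hpos : 0 < (m + 3) * (m + 2) := by positivity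
  rw [hfac]
  constructor
  · have := Nat.mul_le_mul_left ((m + 3) * (m + 2)) hC1
    linarith
  · intro hle
    refine hC2 (Nat.le_of_mul_le_mul_left (c := (m + 3) * (m + 2)) ?_ hpos)
    linarith

/-- There are three conjugates of `s 0`, and its powers centralize it, so the order is at least
three times `orderOf (s 0)`. -/
theorem six_le_card {G : Type*} [Group G] [Finite G] (s : ℕ → G) (hs : IsBraidSeq 2 s)
    (h01 : s 0 ≠ s 1) : 6 ≤ Nat.card G ∧ (Nat.card G ≤ 6 → s 0 ^ 2 = 1) := by
  have hcl := hs.card_class_mul_le h01 (Or.inl rfl) (Subgroup.zpowers (s 0)) (by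
    intro c hc
    exact Subgroup.mem_centralizer_singleton_iff.1 ((Subgroup.zpowers_le.2
      (Subgroup.mem_centralizer_singleton_iff.2 rfl)) hc))
  rw [Nat.card_zpowers] at hcl
  have h1 : orderOf (s 0) ≠ 1 := by
    rw [Ne, orderOf_eq_one_iff]
    intro h1
    have := hs.braid 0 (by omega)
    rw [h1] at this
    simp only [one_mul, mul_one] at this
    exact h01 (by rw [h1]; exact mul_left_cancel (a := s (0 + 1)) (by simpa using this))
  have h0 : 0 < orderOf (s 0) := orderOf_pos _
  refine ⟨by omega, fun hle => ?_⟩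
  have : orderOf (s 0) = 2 := by omega
  rw [← this, pow_orderOf_eq_one]

end IsBraidSeq

/-! ### Three commuting generators and sequences of length five. -/

/-- The subgroup of products of powers of three commuting elements. -/
def tripleSpan {G : Type*} [Group G] {x y z : G} (hxy : Commute x y) (hxz : Commute x z)
    (hyz : Commute y z) : Subgroup G where
  carrier := {g | ∃ a b c : ℤ, g = x ^ a * y ^ b * z ^ c}
  one_mem' := ⟨0, 0, 0, by simp⟩
  mul_mem' := by
    rintro _ _ ⟨a, b, c, rfl⟩ ⟨a', b', c', rfl⟩
    refine ⟨a + a', b + b', c + c', ?_⟩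
    have h1 : Commute (y ^ b * z ^ c) (x ^ a') :=
      ((hxy.symm.zpow_zpow b a')).mul_left (hxz.symm.zpow_zpow c a')
    have h2 : Commute (z ^ c) (y ^ b') := hyz.symm.zpow_zpow c b'
    calc x ^ a * y ^ b * z ^ c * (x ^ a' * y ^ b' * z ^ c')
        = x ^ a * ((y ^ b * z ^ c) * x ^ a') * y ^ b' * z ^ c' := by group
      _ = x ^ a * x ^ a' * y ^ b * (z ^ c * y ^ b') * z ^ c' := by rw [h1.eq]; group
      _ = _ := by rw [h2.eq]; group
  inv_mem' := by
    rintro _ ⟨a, b, c, rfl⟩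
    refine ⟨-a, -b, -c, ?_⟩
    have h1 : Commute (x ^ (-a)) (y ^ (-b) * z ^ (-c)) :=
      (hxy.zpow_zpow _ _).mul_right (hxz.zpow_zpow _ _)
    have h2 : Commute (y ^ (-b)) (z ^ (-c)) := hyz.zpow_zpow _ _
    rw [mul_assoc _ (y ^ (-b)), h1.eq, h2.eq]
    group

theorem card_mul_card_le_of_cosets {G : Type*} [Group G] [Finite G] {ι : Type*}
    {X A : Subgroup G} (hX : X ≤ A) (g : ι → G) (hg : ∀ i, g i ∈ A)
    (h : ∀ i j, i ≠ j → (g i)⁻¹ * g j ∉ X) : Nat.card ι * Nat.card X ≤ Nat.card A := by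
  rw [← Nat.card_prod]
  refine Nat.card_le_card_of_injective
    (fun p : ι × X => (⟨g p.1 * p.2, A.mul_mem (hg _) (hX p.2.2)⟩ : A)) ?_
  rintro ⟨i, c, hc⟩ ⟨j, d, hd⟩ hij
  have e : g i * c = g j * d := congrArg Subtype.val hij
  obtain rfl : i = j := by
    by_contra hne
    refine h i j hne ?_
    have : (g i)⁻¹ * g j = c * d⁻¹ := by
      rw [inv_mul_eq_iff_eq_mul, ← mul_assoc, e]; group
    rw [this]
    exact X.mul_mem hc (X.inv_mem hd)
  have : c = d := mul_left_cancel e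
  subst this
  rfl

theorem three_mul_card_le {G : Type*} [Group G] [Finite G] {X A : Subgroup G} (hX : X ≤ A)
    {g h : G} (hg : g ∈ A) (hh : h ∈ A) (hgX : g ∉ X) (hhX : h ∉ X) (hgh : g⁻¹ * h ∉ X) :
    3 * Nat.card X ≤ Nat.card A := by
  have hhg : h⁻¹ * g ∉ X := fun k => hgh (by simpa using X.inv_mem k)
  have := card_mul_card_le_of_cosets hX ![1, g, h]
    (by intro i; fin_cases i <;> simp [A.one_mem, hg, hh])
    (by intro i j; fin_cases i <;> fin_cases j <;> simp [hgX, hhX, hgh, hhg])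
  simpa using this

/-- A lower bound for the order of the group generated by three commuting elements which are
permuted transitively by inner automorphisms. -/
theorem card_tripleSpan {G : Type*} [Group G] [Finite G] {x y z u v : G} (hxy : Commute x y)
    (hxz : Commute x z) (hyz : Commute y z) (ne_yz : y ≠ z) (ne_xy : x ≠ y) (hne : z ≠ x * y)
    (ux : u * x = y * u) (uy : u * y = x * u) (uz : u * z = z * u)
    (vx : v * x = x * v) (vy : v * y = z * v) (vz : v * z = y * v) :
    8 ≤ Nat.card (tripleSpan hxy hxz hyz) ∧
      (Nat.card (tripleSpan hxy hxz hyz) ≤ 8 → x ^ 2 = 1) := by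
  have hconj : ∀ {g a b : G}, g * a = b * g → ∀ k : ℤ, g * a ^ k * g⁻¹ = b ^ k := by
    intro g a b h k
    rw [← conj_zpow, h, mul_inv_cancel_right]
  have ux' := hconj ux
  have uy' := hconj uy
  have vx' := hconj vx
  have vy' := hconj vy
  have vz' := hconj vz
  set A := tripleSpan hxy hxz hyz with hA
  have hXA : Subgroup.zpowers x ≤ A := by
    rw [Subgroup.zpowers_le]; exact ⟨1, 0, 0, by simp⟩
  have hyA : y ∈ A := ⟨0, 1, 0, by simp⟩
  have hzA : z ∈ A := ⟨0, 0, 1, by simp⟩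
  have hyX : y ∉ Subgroup.zpowers x := by
    rintro ⟨k, hk⟩
    have hk : x ^ k = y := hk
    have h1 := vx' k
    have h2 := vy' 1
    rw [hk] at h1
    simp only [zpow_one] at h2
    exact ne_yz (h1.symm.trans h2)
  have hzX : z ∉ Subgroup.zpowers x := by
    rintro ⟨k, hk⟩
    have hk : x ^ k = z := hk
    have h1 := vx' k
    have h2 := vz' 1
    rw [hk] at h1
    simp only [zpow_one] at h2
    exact ne_yz (h2.symm.trans h1)
  have hx1 : x ≠ 1 := by
    intro h
    have h1 := ux' 1
    simp only [zpow_one, h] at h1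
    exact ne_xy (by rw [h, ← h1]; group)
  have hcX : Nat.card (Subgroup.zpowers x) = orderOf x := Nat.card_zpowers x
  by_cases hsq : x ^ 2 = 1
  · refine ⟨?_, fun _ => hsq⟩
    have hm : orderOf x = 2 := orderOf_eq_prime hsq hx1
    have hy2 : y ^ 2 = 1 := by
      have := ux' 2
      have h' : x ^ (2 : ℤ) = 1 := by exact_mod_cast hsq
      rw [h'] at this
      have h2 : y ^ (2 : ℤ) = 1 := by rw [← this]; group
      exact_mod_cast h2
    have h01 : ∀ {w : G}, w ^ 2 = 1 → ∀ k : ℤ, w ^ k = 1 ∨ w ^ k = w := by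
      intro w hw k
      have h' : w ^ (2 : ℤ) = 1 := by exact_mod_cast hw
      obtain ⟨l, rfl | rfl⟩ := Int.even_or_odd' k
      · left; rw [zpow_mul, h', one_zpow]
      · right; rw [zpow_add, zpow_mul, h', one_zpow, one_mul, zpow_one]
    -- The chain `⟨x⟩ < ⟨x, y⟩ < A` doubles the order twice. For involutions the middle group
    -- consists of `1, x, y, xy`, none of which is `z`.
    set B := tripleSpan hxy (Commute.one_right x) (Commute.one_right y) with hB
    have hXB : Subgroup.zpowers x < B := by
      refine lt_of_le_of_ne ?_ ?_
      · rw [Subgroup.zpowers_le]; exact ⟨1, 0, 0, by simp⟩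
      · intro h
        exact hyX (h ▸ (⟨0, 1, 0, by simp⟩ : y ∈ B))
    have hBA : B < A := by
      refine lt_of_le_of_ne ?_ ?_
      · rintro _ ⟨a, b, c, rfl⟩
        exact ⟨a, b, 0, by simp⟩
      · intro h
        have : z ∈ B := h ▸ hzA
        obtain ⟨a, b, c, h⟩ := this
        rw [one_zpow, mul_one] at h
        rcases h01 hsq a with ha | ha <;> rcases h01 hy2 b with hb | hb <;> rw [ha, hb] at h
        · exact hzX (by rw [h, one_mul]; exact Subgroup.one_mem _)
        · exact ne_yz (by rw [h, one_mul])
        · exact hzX (by rw [h, mul_one]; exact Subgroup.mem_zpowers x)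
        · exact hne h
    have h1 := two_mul_card_le_of_lt hXB
    have h2 := two_mul_card_le_of_lt hBA
    omega
  -- When `x` has order at least three, index at least three already gives nine elements. In the
  -- remaining case `y⁻¹ z` and `y⁻²` are powers of `x`, and the order of `x` can only be `3` or
  -- `4`.
  · suffices 9 ≤ Nat.card A from ⟨by omega, fun h => by omega⟩
    have hm3 : 3 ≤ orderOf x := by
      have h0 : 0 < orderOf x := orderOf_pos x
      have h1 : orderOf x ≠ 1 := by rwa [Ne, orderOf_eq_one_iff]
      have h2 : orderOf x ≠ 2 := fun h => hsq (by rw [← h, pow_orderOf_eq_one])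
      omega
    by_cases hyz' : y⁻¹ * z ∈ Subgroup.zpowers x
    swap
    · have := three_mul_card_le hXA hyA hzA hyX hzX hyz'
      omega
    by_cases hyy : y⁻¹ * y⁻¹ ∈ Subgroup.zpowers x
    swap
    · have := three_mul_card_le hXA hyA (A.inv_mem hyA) hyX
        (fun h => hyX (by simpa using Subgroup.inv_mem _ h)) hyy
      omega
    have h2 := two_mul_card_le_of_lt (lt_of_le_of_ne hXA (fun h => hyX (by rw [h]; exact hyA)))
    by_contra hlt
    have hm4 : orderOf x = 3 ∨ orderOf x = 4 := by omega
    obtain ⟨k, hk⟩ := hyz'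
    have hk : x ^ k = y⁻¹ * z := hk
    have hz : z = y * x ^ k := by rw [hk]; group
    -- Conjugation by `v` exchanges `y` and `z` and fixes `x`; combined with `hz` this forces `x ^
    -- (2 * k) = 1`.
    have hy : y = z * x ^ k := by
      have e : v * z * v⁻¹ = (v * y * v⁻¹) * (v * x ^ k * v⁻¹) := by rw [hz]; group
      rw [vx', vz, vy] at e
      simpa using e
    have h2k : x ^ (2 * k) = 1 := by
      have : y = y * (x ^ k * x ^ k) := by rw [← mul_assoc, ← hz, ← hy]
      rw [two_mul, zpow_add]
      exact (mul_eq_left.1 this.symm)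
    rcases hm4 with hm | hm
    · have h3 : x ^ (3 : ℤ) = 1 := by
        have := pow_orderOf_eq_one x
        rw [hm] at this
        exact_mod_cast this
      have : x ^ k = 1 := by
        have e : k = 3 * k - 2 * k := by ring
        rw [e, zpow_sub, h2k, zpow_mul, h3]; simp
      exact ne_yz (by rw [hz, this, mul_one])
    · have hd : (4 : ℤ) ∣ 2 * k := by
        have := orderOf_dvd_iff_zpow_eq_one.2 h2k
        rw [hm] at this
        exact_mod_cast this
      obtain ⟨l, rfl⟩ : ∃ l, k = l * 2 := ⟨k / 2, by omega⟩
      -- The product `u * v * u` exchanges `x` and `z` and fixes `y`.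
      have hx : x = y * z ^ (l * 2) := by
        have e : (u * v * u) * z * (u * v * u)⁻¹ =
            ((u * v * u) * y * (u * v * u)⁻¹) * ((u * v * u) * x ^ (l * 2) * (u * v * u)⁻¹) := by
          rw [hz]; group
        have e1 : (u * v * u) * z = x * (u * v * u) := by
          rw [mul_assoc (u * v), uz, mul_assoc u, ← mul_assoc v, vz, ← mul_assoc, ← mul_assoc, uy]
          group
        have e2 : (u * v * u) * y = y * (u * v * u) := by
          rw [mul_assoc (u * v), uy, mul_assoc u, ← mul_assoc v, vx, ← mul_assoc, ← mul_assoc, ux]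
          group
        have e3 : (u * v * u) * x = z * (u * v * u) := by
          rw [mul_assoc (u * v), ux, mul_assoc u, ← mul_assoc v, vy, ← mul_assoc, ← mul_assoc, uz]
          group
        rw [e1, e2, hconj e3] at e
        rwa [mul_inv_cancel_right, mul_inv_cancel_right] at e
      rw [hz, (hxy.symm.zpow_right _).mul_zpow] at hx
      refine hyX ?_
      -- Substituting `z` in `hx` leaves an odd power of `y` times a power of `x`; since `y⁻²` is a
      -- power of `x`, so is `y`.
      have e : y = x * (x ^ (l * 2)) ^ (-(l * 2)) * ((y⁻¹ * y⁻¹) ^ l) := by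
        have e1 : (y⁻¹ * y⁻¹) ^ l = y ^ (-(l * 2)) := by
          rw [← zpow_neg_one, ← zpow_add, ← zpow_mul]; congr 1; ring
        rw [e1, zpow_neg, zpow_neg]
        generalize (x ^ (l * 2)) ^ (l * 2) = X at hx
        generalize y ^ (l * 2) = Y at hx
        rw [hx]
        group
      rw [e]
      exact Subgroup.mul_mem _ (Subgroup.mul_mem _ (Subgroup.mem_zpowers x)
        (Subgroup.zpow_mem _ (Subgroup.zpow_mem _ (Subgroup.mem_zpowers x) _) _))
        (Subgroup.zpow_mem _ hyy _)

namespace IsBraidSeq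

variable {G : Type*} [Group G] {m : ℕ} {s : ℕ → G}

theorem swap_left (hs : IsBraidSeq m s) {i : ℕ} (hi : i + 2 < m) :
    s (i + 1) * s i * s (i + 2) * s (i + 1) * s i =
      s (i + 2) * (s (i + 1) * s i * s (i + 2) * s (i + 1)) := by
  have h1 := hs.braid i (by omega)
  have h2 := hs.braid (i + 1) (by omega)
  have h3 := hs.comm i (i + 2) le_rfl hi
  calc s (i + 1) * s i * s (i + 2) * s (i + 1) * s i
      = s (i + 1) * (s i * s (i + 2)) * s (i + 1) * s i := by group
    _ = s (i + 1) * s (i + 2) * (s i * s (i + 1) * s i) := by rw [h3]; group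
    _ = (s (i + 1) * s (i + 2) * s (i + 1)) * s i * s (i + 1) := by rw [h1]; group
    _ = s (i + 2) * s (i + 1) * (s (i + 2) * s i) * s (i + 1) := by rw [h2]; group
    _ = _ := by rw [← h3]; group

theorem swap_right (hs : IsBraidSeq m s) {i : ℕ} (hi : i + 2 < m) :
    s (i + 1) * s i * s (i + 2) * s (i + 1) * s (i + 2) =
      s i * (s (i + 1) * s i * s (i + 2) * s (i + 1)) := by
  have h1 := hs.braid i (by omega)
  have h2 := hs.braid (i + 1) (by omega)
  calc s (i + 1) * s i * s (i + 2) * s (i + 1) * s (i + 2)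
      = s (i + 1) * s i * (s (i + 2) * s (i + 1) * s (i + 2)) := by group
    _ = (s (i + 1) * s i * s (i + 1)) * s (i + 2) * s (i + 1) := by rw [← h2]; group
    _ = _ := by rw [← h1]; group

/-- Length five cannot be reached from length three. Instead `720 = 15 * 6 * 8`: fifteen arcs are
conjugates of `s 0`; six arcs on the last four points are conjugates of `s 2` inside the centralizer
of `s 0`; and `s 0, s 2, s 4` generate at least eight elements centralizing `s 2`. -/
theorem factorial_six_le_card [Finite G] (hs : IsBraidSeq 5 s) (h01 : s 0 ≠ s 1) :
    720 ≤ Nat.card G ∧ (Nat.card G ≤ 720 → s 0 ^ 2 = 1) := by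
  have h02 : Commute (s 0) (s 2) := hs.commute (by omega) (by omega) (by omega)
  have h04 : Commute (s 0) (s 4) := hs.commute (by omega) (by omega) (by omega)
  have h24 : Commute (s 2) (s 4) := hs.commute (by omega) (by omega) (by omega)
  have h03 : Commute (s 0) (s 3) := hs.commute (by omega) (by omega) (by omega)
  have h14 : Commute (s 1) (s 4) := hs.commute (by omega) (by omega) (by omega)
  have hs0 : s 0 ≠ 1 := by
    intro h
    exact hs.not_commute_succ h01 (i := 0) (by omega) (by rw [h]; exact Commute.one_left _)
  have hne2 : s 0 ≠ s 2 := fun h =>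
    hs.not_commute_succ h01 (i := 2) (by omega) (by rw [← h]; exact h03)
  have hne4 : s 2 ≠ s 4 := fun h =>
    hs.not_commute_succ h01 (i := 1) (by omega) (by
      change Commute (s 1) (s 2); rw [h]; exact h14)
  -- Since `s 0` commutes with `s 2` and `s 3`, putting `s 4 = s 0 * s 2` in the last braid relation
  -- leaves one factor `s 0` too many, so `s 0 = 1`.
  have hne : s 4 ≠ s 0 * s 2 := by
    intro h
    have hb := hs.braid 3 (by omega)
    have hb' := hs.braid 2 (by omega)
    simp only [Nat.reduceAdd] at hb hb'
    apply hs0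
    have e1 : s 3 * s 4 * s 3 = s 0 * (s 3 * s 2 * s 3) := by
      rw [h, ← mul_assoc, ← h03.eq]; group
    have e2 : s 4 * s 3 * s 4 = s 0 * (s 0 * (s 2 * s 3 * s 2)) := by
      calc s 4 * s 3 * s 4 = s 0 * ((s 2 * s 3) * s 0) * s 2 := by rw [h]; group
        _ = _ := by rw [← (h02.mul_right h03).eq]; group
    rw [e1, e2, hb'] at hb
    exact (mul_eq_right.1 (mul_left_cancel hb).symm)
  have hA := card_tripleSpan (u := s 1 * s 0 * s 2 * s 1) (v := s 3 * s 2 * s 4 * s 3)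
    h02 h04 h24 hne4 hne2 hne (hs.swap_left (i := 0) (by omega)) (hs.swap_right (i := 0) (by omega))
    (((h14.mul_left h04).mul_left h24).mul_left h14).eq
    ((((h03.mul_right h02).mul_right h04).mul_right h03).symm).eq
    (hs.swap_left (i := 2) (by omega)) (hs.swap_right (i := 2) (by omega))
  set A := tripleSpan h02 h04 h24 with hAdef
  have hcent : ∀ {w : G}, Commute w (s 0) → Commute w (s 2) → Commute w (s 4) →
      ∀ c ∈ A, Commute c w := by
    rintro w h0 h2 h4 _ ⟨a, b, c, rfl⟩
    exact (((h0.symm.zpow_left a).mul_left (h2.symm.zpow_left b)).mul_left (h4.symm.zpow_left c))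
  set K := Subgroup.centralizer {s 0} with hK
  have hsK : ∀ p, 2 ≤ p → p < 5 → s p ∈ K := fun p h1 h2 =>
    Subgroup.mem_centralizer_singleton_iff.2 (hs.commute (by omega) h2 (by omega)).eq
  have hAK : A ≤ K := fun c hc => Subgroup.mem_centralizer_singleton_iff.2
    (hcent (Commute.refl _) h02 h04 c hc).eq
  have hcK := card_mul_card_le_of_conj (ι := Σ j : Fin 4, Fin j) K A hAK (s 2)
    (hcent h02.symm (Commute.refl _) h24) (fun p => arc s (p.2 + 2) (p.1 - p.2 - 1)) ?_ ?_
  · have hclass := hs.card_class_mul_le h01 (by omega) K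
      (fun c hc => Subgroup.mem_centralizer_singleton_iff.1 hc)
    have h6 := card_sigma_fin_mul_two 4
    have h6' : Nat.card (Σ j : Fin 4, Fin j) = 6 := by omega
    rw [h6'] at hcK
    refine ⟨by omega, fun h => hA.2 (by omega)⟩
  · rintro ⟨⟨j, hj⟩, ⟨i, hi⟩⟩ ⟨⟨j', hj'⟩, ⟨i', hi'⟩⟩ h
    have hi0 : i < j := hi
    have hi0' : i' < j' := hi'
    have h' : arc s (i + 2) ((j + 2) - (i + 2) - 1) = arc s (i' + 2) ((j' + 2) - (i' + 2) - 1) := by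
      rw [Nat.add_sub_add_right, Nat.add_sub_add_right]
      exact h
    -- Injectivity is taken from the whole sequence: the shifted one has length three, where it can
    -- fail.
    obtain ⟨h1, h2⟩ := hs.arc_injective h01 (by omega) (by omega) (by omega) (by omega)
      (by omega) h'
    obtain rfl : i = i' := by omega
    obtain rfl : j = j' := by omega
    rfl
  · rintro ⟨⟨j, hj⟩, ⟨i, hi⟩⟩
    have hi0 : i < j := hi
    obtain ⟨g, hg, hg'⟩ := exists_conj_arc (s := s) (i + 2) (j - i - 1) K
      (fun p h1 h2 => hsK p (by omega) (by omega))
    have hsh : IsBraidSeq 3 (fun i => s (i + 2)) := hs.shift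
    obtain ⟨k, hk, hk'⟩ := hsh.exists_conj_term (i := i) (by omega) K
      (fun p hp => hsK _ (by omega) (by omega))
    refine ⟨g * k, K.mul_mem hg hk, ?_⟩
    change arc s (i + 2) (j - i - 1) = _
    have hk'' : s (i + 2) = k * s 2 * k⁻¹ := hk'
    rw [hg', hk'']; group

/-- A finite group generated by a nonconstant braid sequence with `m ≠ 3` terms has at least
`(m + 1)!` elements, and in case of equality the terms are involutions. -/
theorem factorial_le_card.{u} {m : ℕ} (hm : m = 2 ∨ 4 ≤ m) (G : Type u) [Group G] [Finite G]
    (s : ℕ → G) (hs : IsBraidSeq m s) (h01 : s 0 ≠ s 1) :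
    (m + 1).factorial ≤ Nat.card G ∧ (Nat.card G ≤ (m + 1).factorial → s 0 ^ 2 = 1) := by
  induction m using Nat.strong_induction_on generalizing G with
  | _ m ih =>
    by_cases h2 : m = 2
    · subst h2; exact six_le_card s hs h01
    by_cases h5 : m = 5
    · subst h5; exact hs.factorial_six_le_card h01
    obtain ⟨k, rfl⟩ : ∃ k, m = k + 2 := ⟨m - 2, by omega⟩
    exact factorial_le_card_step (by omega)
      (fun H _ _ t ht ht' => ih k (by omega) (by omega) H t ht ht') s hs h01

end IsBraidSeq

/-! ### Artin generators and the permutation of a braid. -/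

open Equiv in
/-- The transposition of `p` and `p + 1`. -/
def adjSwap (m p : ℕ) : Perm (Fin (m + 1)) :=
  if h : p < m then swap ⟨p, by omega⟩ ⟨p + 1, by omega⟩ else 1

/-- The `i`-th Artin generator. -/
def sigma (m i : ℕ) : BraidGroup (m + 1) :=
  if h : i < m then PresentedGroup.of (⟨i, h⟩ : Fin (m + 1 - 1)) else 1

theorem sigma_eq_of {m i : ℕ} (h : i < m) :
    sigma m i = PresentedGroup.of (⟨i, h⟩ : Fin (m + 1 - 1)) := dif_pos h

theorem sigma_isBraidSeq (m : ℕ) : IsBraidSeq m (sigma m) where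
  braid i hi := by
    rw [sigma_eq_of hi, sigma_eq_of (by omega : i < m)]
    exact PresentedGroup.mk_eq_mk_of_mul_inv_mem (Or.inl ⟨⟨i, by omega⟩, ⟨i + 1, hi⟩, rfl, rfl⟩)
  comm i j hij hj := by
    rw [sigma_eq_of hj, sigma_eq_of (by omega : i < m)]
    exact PresentedGroup.mk_eq_mk_of_mul_inv_mem (Or.inr ⟨⟨i, by omega⟩, ⟨j, hj⟩, hij, rfl⟩)

theorem mem_of_sigma_mem {m : ℕ} (K : Subgroup (BraidGroup (m + 1)))
    (h : ∀ i < m, sigma m i ∈ K) (x : BraidGroup (m + 1)) : x ∈ K :=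
  PresentedGroup.generated_by _ K (fun j => by
    have := h j j.2
    rwa [sigma_eq_of (show (j : ℕ) < m from j.2)] at this) x

theorem braid_induction {m : ℕ} {C : BraidGroup (m + 1) → Prop} (one : C 1)
    (gen : ∀ i < m, C (sigma m i)) (mul : ∀ x y, C x → C y → C (x * y))
    (inv : ∀ x, C x → C x⁻¹) (x : BraidGroup (m + 1)) : C x :=
  mem_of_sigma_mem
    { carrier := {x | C x}, mul_mem' := fun hx hy => mul _ _ hx hy, one_mem' := one
      inv_mem' := fun hx => inv _ hx } gen x

theorem exists_braidLift {m : ℕ} {G : Type*} [Group G] {s : ℕ → G} (hs : IsBraidSeq m s) :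
    ∃ f : BraidGroup (m + 1) →* G, ∀ i < m, f (sigma m i) = s i := by
  refine ⟨PresentedGroup.toGroup (f := fun i : Fin (m + 1 - 1) => s i) ?_, fun i hi => ?_⟩
  · rintro _ (⟨i, j, hij, rfl⟩ | ⟨i, j, hij, rfl⟩)
    · have hj : (j : ℕ) < m := j.2
      have := hs.braid i (by omega)
      rw [hij] at this
      simp [this]
    · have := hs.comm i j hij j.2
      simp [this]
  · rw [sigma_eq_of hi, PresentedGroup.toGroup.of]

theorem braidHom_ext {m : ℕ} {G : Type*} [Group G] {f g : BraidGroup (m + 1) →* G}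
    (h : ∀ i < m, f (sigma m i) = g (sigma m i)) : f = g :=
  MonoidHom.ext fun x => mem_of_sigma_mem (f.eqLocus g) h x

theorem adjSwap_val {m p : ℕ} (h : p < m) (i : Fin (m + 1)) :
    (adjSwap m p i : ℕ) = if (i : ℕ) = p then p + 1 else if (i : ℕ) = p + 1 then p else i := by
  rw [adjSwap, dif_pos h, Equiv.swap_apply_def]
  simp only [Fin.ext_iff]
  split_ifs <;> rfl

theorem adjSwap_sq {m p : ℕ} : adjSwap m p * adjSwap m p = 1 := by
  unfold adjSwap
  split_ifs <;> simp

theorem adjSwap_isBraidSeq (m : ℕ) : IsBraidSeq m (adjSwap m) where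
  braid i hi := by
    ext x
    have h : i < m := by omega
    simp only [Equiv.Perm.mul_apply, adjSwap_val hi, adjSwap_val h]
    split_ifs <;> omega
  comm i j hij hj := by
    ext x
    have h : i < m := by omega
    simp only [Equiv.Perm.mul_apply, adjSwap_val hj, adjSwap_val h]
    split_ifs <;> omega

/-- The permutation induced by a braid. -/
noncomputable def braidPerm (m : ℕ) : BraidGroup (m + 1) →* Equiv.Perm (Fin (m + 1)) :=
  (exists_braidLift (adjSwap_isBraidSeq m)).choose

theorem braidPerm_sigma {m i : ℕ} (h : i < m) : braidPerm m (sigma m i) = adjSwap m i :=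
  (exists_braidLift (adjSwap_isBraidSeq m)).choose_spec i h

theorem braidPerm_surjective (m : ℕ) : Function.Surjective (braidPerm m) := by
  have h : (⊤ : Submonoid (Equiv.Perm (Fin (m + 1)))) ≤ (braidPerm m).range.toSubmonoid := by
    rw [← Equiv.Perm.mclosure_swap_castSucc_succ, Submonoid.closure_le]
    rintro _ ⟨i, rfl⟩
    refine ⟨sigma m i, ?_⟩
    rw [braidPerm_sigma i.2, adjSwap, dif_pos i.2]
    rfl
  exact fun x => h (Submonoid.mem_top x)

/-! ### The order of a group with a Coxeter presentation of type A -/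

/-- The product `s (m + 1 - l) * ⋯ * s m`. -/
def tailProd {G : Type*} [Group G] (s : ℕ → G) (m : ℕ) : ℕ → G
  | 0 => 1
  | l + 1 => s (m - l) * tailProd s m l

namespace IsBraidSeq

variable {G : Type*} [Group G] {m : ℕ} {s : ℕ → G}

theorem commute_tailProd (hs : IsBraidSeq (m + 1) s) {i l : ℕ} (h : i + l < m) :
    Commute (s i) (tailProd s m l) := by
  induction l with
  | zero => exact Commute.one_right _
  | succ l ih =>
    exact (hs.commute (by omega) (by omega) (by omega)).mul_right (ih (by omega))

theorem mul_tailProd (hs : IsBraidSeq (m + 1) s) {i l : ℕ} (hl : l ≤ m + 1) (hi : i ≤ m)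
    (h : m + 1 < i + l) : s i * tailProd s m l = tailProd s m l * s (i - 1) := by
  induction l generalizing i with
  | zero => omega
  | succ l ih =>
    change s i * (s (m - l) * tailProd s m l) = s (m - l) * tailProd s m l * s (i - 1)
    by_cases hi' : m + 1 < i + l
    · rw [mul_assoc, ← ih (by omega) hi hi', ← mul_assoc, ← mul_assoc,
        (hs.commute (i := i) (j := m - l) (by omega) (by omega) (by omega)).eq]
    · obtain ⟨l, rfl⟩ : ∃ k, l = k + 1 := ⟨l - 1, by omega⟩
      obtain ⟨j, rfl⟩ : ∃ j, i = j + 1 := ⟨i - 1, by omega⟩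
      have e1 : m - l = j + 1 := by omega
      have e2 : m - (l + 1) = j := by omega
      have hb := hs.braid j (by omega)
      have hc := hs.commute_tailProd (i := j) (l := l) (by omega)
      change s (j + 1) * (s (m - (l + 1)) * (s (m - l) * tailProd s m l)) =
        s (m - (l + 1)) * (s (m - l) * tailProd s m l) * s (j + 1 - 1)
      rw [e1, e2, Nat.add_sub_cancel, mul_assoc (s j), mul_assoc (s (j + 1)), ← hc.eq]
      simp only [← mul_assoc]
      rw [hb]

/-- Coset enumeration: with `H` generated by all but the last term, the `m + 2` cosets represented
by `tailProd s m l` are permuted by left multiplication. A term `s i` passes into `H` unchanged,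
lengthens the representative, shortens it, or passes into `H` as `s (i - 1)`, according to the
position of `i + l` relative to `m` and `m + 1`. -/
theorem finite_and_card_le (hs : IsBraidSeq m s) (hsq : ∀ i < m, s i * s i = 1) :
    Finite (Subgroup.closure {x | ∃ i < m, s i = x}) ∧
      Nat.card (Subgroup.closure {x | ∃ i < m, s i = x}) ≤ (m + 1).factorial := by
  induction m with
  | zero =>
    have : {x | ∃ i < 0, s i = x} = (∅ : Set G) := by ext; simp
    rw [this, Subgroup.closure_empty]
    exact ⟨inferInstance, by simp⟩
  | succ m ih =>
    obtain ⟨hf, hc⟩ := ih (hs.mono (by omega)) fun i hi => hsq i (by omega)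
    set H := Subgroup.closure {x | ∃ i < m, s i = x} with hH
    have hsH : ∀ i < m, s i ∈ H := fun i hi => Subgroup.subset_closure ⟨i, hi, rfl⟩
    set T : Set G := {x | ∃ l : Fin (m + 2), ∃ h : H, x = tailProd s m l * h} with hT
    have hmul : ∀ i ≤ m, ∀ x ∈ T, s i * x ∈ T := by
      rintro i hi _ ⟨⟨l, hl⟩, ⟨h, hh⟩, rfl⟩
      rcases lt_trichotomy (i + l) m with hlt | heq | hgt
      · refine ⟨⟨l, hl⟩, ⟨s i * h, H.mul_mem (hsH i (by omega)) hh⟩, ?_⟩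
        change s i * (tailProd s m l * h) = tailProd s m l * (s i * h)
        rw [← mul_assoc, (hs.commute_tailProd hlt).eq, mul_assoc]
      · refine ⟨⟨l + 1, by omega⟩, ⟨h, hh⟩, ?_⟩
        change s i * (tailProd s m l * h) = s (m - l) * tailProd s m l * h
        rw [show m - l = i by omega, mul_assoc]
      · by_cases h1 : i + l = m + 1
        · obtain ⟨l, rfl⟩ : ∃ k, l = k + 1 := ⟨l - 1, by omega⟩
          refine ⟨⟨l, by omega⟩, ⟨h, hh⟩, ?_⟩
          change s i * (s (m - l) * tailProd s m l * h) = tailProd s m l * h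
          rw [show m - l = i by omega, ← mul_assoc, ← mul_assoc, hsq i (by omega), one_mul]
        · refine ⟨⟨l, hl⟩, ⟨s (i - 1) * h, H.mul_mem (hsH _ (by omega)) hh⟩, ?_⟩
          change s i * (tailProd s m l * h) = tailProd s m l * (s (i - 1) * h)
          rw [← mul_assoc, hs.mul_tailProd (by omega) hi (by omega), mul_assoc]
    have hKT : ∀ x ∈ Subgroup.closure {x | ∃ i < m + 1, s i = x}, x ∈ T := by
      intro x hx
      induction hx using Subgroup.closure_induction_left with
      | one => exact ⟨0, 1, by simp [tailProd]⟩
      | mul_left x hx y hy ih =>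
        obtain ⟨i, hi, rfl⟩ := hx
        exact hmul i (by omega) y ih
      | inv_mul_cancel x hx y hy ih =>
        obtain ⟨i, hi, rfl⟩ := hx
        rw [inv_eq_of_mul_eq_one_left (hsq i hi)]
        exact hmul i (by omega) y ih
    choose l h hlh using fun x : Subgroup.closure {x | ∃ i < m + 1, s i = x} => hKT x x.2
    have hinj : Function.Injective (fun x => (l x, h x)) := by
      intro x y hxy
      have h1 : l x = l y := congrArg Prod.fst hxy
      have h2 : h x = h y := congrArg Prod.snd hxy
      exact Subtype.ext (by rw [hlh x, hlh y, h1, h2])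
    refine ⟨Finite.of_injective _ hinj, (Nat.card_le_card_of_injective _ hinj).trans ?_⟩
    rw [Nat.card_prod, Nat.card_eq_fintype_card, Fintype.card_fin, Nat.factorial_succ (m + 1)]
    exact Nat.mul_le_mul_left _ hc

end IsBraidSeq

/-! ### The pure braid group is characteristic. -/

/-- The pure braid group is the normal closure of the squares of the generators. -/
theorem mem_normalClosure_of_braidPerm_eq_one {m : ℕ} {x : BraidGroup (m + 1)}
    (hx : braidPerm m x = 1) :
    x ∈ Subgroup.normalClosure {y | ∃ i < m, sigma m i * sigma m i = y} := by
  set N := Subgroup.normalClosure {y | ∃ i < m, sigma m i * sigma m i = y} with hN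
  have hle : N ≤ (braidPerm m).ker := by
    refine Subgroup.normalClosure_le_normal ?_
    rintro _ ⟨i, hi, rfl⟩
    rw [SetLike.mem_coe, MonoidHom.mem_ker, map_mul, braidPerm_sigma hi, adjSwap_sq]
  have hQ := (((sigma_isBraidSeq m).map (QuotientGroup.mk' N)).finite_and_card_le (by
    intro i hi
    simp only [← map_mul]
    have hmem : sigma m i * sigma m i ∈ N := Subgroup.subset_normalClosure ⟨i, hi, rfl⟩
    exact (QuotientGroup.eq_one_iff (N := N) _).2 hmem))
  have htop : Subgroup.closure {x | ∃ i < m, QuotientGroup.mk' N (sigma m i) = x} = ⊤ := by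
    rw [eq_top_iff]
    rintro x -
    obtain ⟨x, rfl⟩ := QuotientGroup.mk'_surjective N x
    exact mem_of_sigma_mem ((Subgroup.closure {x | ∃ i < m, QuotientGroup.mk' N (sigma m i) = x}).comap
      (QuotientGroup.mk' N))
      (fun i hi => Subgroup.mem_comap.2 (Subgroup.subset_closure ⟨i, hi, rfl⟩)) x
  rw [htop] at hQ
  have hfin : Finite (BraidGroup (m + 1) ⧸ N) :=
    have := hQ.1
    Finite.of_equiv _ Subgroup.topEquiv.toEquiv
  have hcard := hQ.2
  rw [Subgroup.card_top] at hcard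
  set f := QuotientGroup.lift N (braidPerm m) hle with hf
  have hsurj : Function.Surjective f := fun y => by
    obtain ⟨x, rfl⟩ := braidPerm_surjective m y
    exact ⟨QuotientGroup.mk x, rfl⟩
  -- The quotient by `N` has at most `(m + 1)!` elements and maps onto the symmetric group, so the
  -- map is bijective and its kernel is trivial.
  have hb := hsurj.bijective_of_nat_card_le (by
    rw [Nat.card_perm, Nat.card_fin]; exact hcard)
  exact (QuotientGroup.eq_one_iff x).1 (hb.1 (by rw [map_one]; exact hx))

/-- Automorphisms of the braid group send the squares of the generators to pure braids. -/
theorem braidPerm_aut_sigma_sq {m : ℕ} (hm : m = 2 ∨ 4 ≤ m)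
    (φ : BraidGroup (m + 1) ≃* BraidGroup (m + 1)) {i : ℕ} (hi : i < m) :
    braidPerm m (φ (sigma m i * sigma m i)) = 1 := by
  set f := (braidPerm m).comp φ.toMonoidHom with hf
  have hfs : Function.Surjective f := (braidPerm_surjective m).comp φ.surjective
  have hs := (sigma_isBraidSeq m).map f
  -- If these images agreed, all generators would have the same image and the symmetric group would
  -- be cyclic.
  have h01 : f (sigma m 0) ≠ f (sigma m 1) := by
    intro h
    have hall : ∀ i < m, f (sigma m i) = f (sigma m 0) := by
      intro i hi
      have hsucc : ∀ i, i + 1 < m → f (sigma m i) = f (sigma m (i + 1)) := by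
        intro i
        induction i with
        | zero => exact fun _ => h
        | succ i ih => exact fun hi => (hs.eq_succ_of_eq (by omega)).1 (ih (by omega))
      induction i with
      | zero => rfl
      | succ i ih => rw [← hsucc i hi, ih (by omega)]
    have hz : ∀ x, f x ∈ Subgroup.zpowers (f (sigma m 0)) :=
      fun x => mem_of_sigma_mem ((Subgroup.zpowers (f (sigma m 0))).comap f)
        (fun i hi => by
          rw [Subgroup.mem_comap, hall i hi]; exact Subgroup.mem_zpowers _) x
    obtain ⟨x, hx⟩ := hfs (adjSwap m 0)
    obtain ⟨y, hy⟩ := hfs (adjSwap m 1)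
    obtain ⟨a, ha⟩ := hz x
    obtain ⟨b, hb⟩ := hz y
    have hab : adjSwap m 0 * adjSwap m 1 = adjSwap m 1 * adjSwap m 0 := by
      rw [← hx, ← hy, ← ha, ← hb]
      exact (Commute.refl (f (sigma m 0))).zpow_zpow a b
    have := congrArg Fin.val (DFunLike.congr_fun hab (⟨0, by omega⟩ : Fin (m + 1)))
    simp only [Equiv.Perm.mul_apply, adjSwap_val (show 0 < m by omega),
      adjSwap_val (show 1 < m by omega)] at this
    simp at this
  -- The symmetric group attains the lower bound, so the equality clause applies.
  have h2 := (IsBraidSeq.factorial_le_card hm _ _ hs h01).2 (by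
    rw [Nat.card_perm, Nat.card_fin])
  obtain ⟨g, -, hg⟩ := hs.exists_conj_term hi ⊤ (by simp)
  change f (sigma m i * sigma m i) = 1
  rw [map_mul, ← pow_two, hg, conj_pow, h2]
  simp

theorem braidPerm_aut_eq_one {m : ℕ} (hm : m = 2 ∨ 4 ≤ m)
    (φ : BraidGroup (m + 1) ≃* BraidGroup (m + 1)) {x : BraidGroup (m + 1)}
    (hx : braidPerm m x = 1) : braidPerm m (φ x) = 1 := by
  have hle : Subgroup.normalClosure {y | ∃ i < m, sigma m i * sigma m i = y} ≤
      ((braidPerm m).comp φ.toMonoidHom).ker := by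
    refine Subgroup.normalClosure_le_normal ?_
    rintro _ ⟨i, hi, rfl⟩
    exact braidPerm_aut_sigma_sq hm φ hi
  exact hle (mem_normalClosure_of_braidPerm_eq_one hx)

/-! ### Additive functions and infinitely many Reidemeister classes. -/

/-- `f` is additive on the kernel of `π`. -/
def AdditiveOnKer {G Q : Type*} [Group G] [Group Q] (π : G →* Q) (f : G → ℚ) : Prop :=
  ∀ x y, π x = 1 → π y = 1 → f (x * y) = f x + f y

namespace AdditiveOnKer

variable {G Q : Type*} [Group G] [Group Q] {π : G →* Q} {f f' : G → ℚ}

theorem map_one (hf : AdditiveOnKer π f) : f 1 = 0 := by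
  have := hf 1 1 (_root_.map_one π) (_root_.map_one π)
  rw [mul_one] at this
  linarith

theorem map_inv (hf : AdditiveOnKer π f) {x : G} (hx : π x = 1) : f x⁻¹ = - f x := by
  have := hf x x⁻¹ hx (by rw [_root_.map_inv, hx, inv_one])
  rw [mul_inv_cancel, hf.map_one] at this
  linarith

theorem map_pow (hf : AdditiveOnKer π f) {x : G} (hx : π x = 1) (k : ℕ) :
    f (x ^ k) = k * f x := by
  induction k with
  | zero => simp [hf.map_one]
  | succ k ih =>
    rw [pow_succ, hf _ _ (by rw [_root_.map_pow, hx, one_pow]) hx, ih]; push_cast; ring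

theorem conj (hf : AdditiveOnKer π f) (g : G) : AdditiveOnKer π (fun x => f (g * x * g⁻¹)) := by
  intro x y hx hy
  have := hf (g * x * g⁻¹) (g * y * g⁻¹) (by simp [hx]) (by simp [hy])
  rw [← this]
  group

theorem conj_eq (hf : AdditiveOnKer π f) {g x : G} (hg : π g = 1) (hx : π x = 1) :
    f (g * x * g⁻¹) = f x := by
  rw [hf _ _ (by simp [hx, hg]) (by simp [hg]), hf _ _ hg hx, hf.map_inv hg]
  ring

theorem add (hf : AdditiveOnKer π f) (hf' : AdditiveOnKer π f') (a b : ℚ) :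
    AdditiveOnKer π (fun x => a * f x + b * f' x) := by
  intro x y hx hy
  simp only [hf x y hx hy, hf' x y hx hy]
  ring

theorem comp_hom (hf : AdditiveOnKer π f) (φ : G →* G) (hφ : ∀ x, π x = 1 → π (φ x) = 1) :
    AdditiveOnKer π (fun x => f (φ x)) := by
  intro x y hx hy
  simp only [_root_.map_mul, hf _ _ (hφ x hx) (hφ y hy)]

end AdditiveOnKer

/-- If `φ`, followed by an inner automorphism, fixes a nonzero additive function on an invariant
normal subgroup, then `φ` has infinitely many Reidemeister classes, provided that only finitely many
cosets of the subgroup can identify these classes. -/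
theorem reidemeisterNumber_eq_top {G Q : Type*} [Group G] [Group Q] (π : G →* Q) (φ : G ≃* G)
    (hφ : ∀ x, π x = 1 → π (φ x) = 1) (a : G)
    (hfin : {q | ∃ g, π g = q ∧ π (g * a * (φ g)⁻¹) = π a}.Finite) {f : G → ℚ}
    (hf : AdditiveOnKer π f) (hinv : ∀ x, π x = 1 → f (a * φ x * a⁻¹) = f x) {p : G}
    (hp : π p = 1) (hfp : f p ≠ 0) : reidemeisterNumber φ = ⊤ := by
  rw [reidemeisterNumber, ENat.card_eq_top]
  by_contra hni
  rw [not_infinite_iff_finite] at hni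
  -- The pigeonhole principle is used twice: infinitely many exponents share a class, and two of the
  -- elements relating them share a coset of the kernel.
  obtain ⟨c, hc⟩ := Finite.exists_infinite_fiber
    (fun k : ℕ => (Quotient.mk (twistedConj φ) (p ^ k * a)))
  obtain ⟨k₀, hk₀⟩ : Nonempty _ := hc.nonempty
  have hex : ∀ k : (fun k : ℕ => (Quotient.mk (twistedConj φ) (p ^ k * a))) ⁻¹' {c},
      ∃ g : G, p ^ (k : ℕ) * a = g * (p ^ k₀ * a) * φ g⁻¹ := fun k =>
    Quotient.exact (s := twistedConj φ)
      ((show _ = c from hk₀).trans (show _ = c from k.2).symm)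
  choose g hg using hex
  have hmem : ∀ k, π (g k) ∈ {q | ∃ g, π g = q ∧ π (g * a * (φ g)⁻¹) = π a} := by
    intro k
    refine ⟨g k, rfl, ?_⟩
    have := congrArg π (hg k)
    simp only [map_mul, map_pow, map_inv, hp, one_pow, one_mul] at this
    simp only [map_mul, map_inv]
    exact this.symm
  have : Finite {q | ∃ g, π g = q ∧ π (g * a * (φ g)⁻¹) = π a} := hfin
  obtain ⟨k, k', hne, hkk⟩ := Finite.exists_ne_map_eq_of_infinite
    (fun k => (⟨π (g k), hmem k⟩ : {q | ∃ g, π g = q ∧ π (g * a * (φ g)⁻¹) = π a}))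
  have hkk : π (g k) = π (g k') := congrArg Subtype.val hkk
  set w := g k * (g k')⁻¹ with hw
  have hw1 : π w = 1 := by rw [hw, map_mul, map_inv, hkk, mul_inv_cancel]
  have e : p ^ (k : ℕ) = w * p ^ (k' : ℕ) * (a * φ w⁻¹ * a⁻¹) := by
    have h1 := hg k
    have h2 := hg k'
    have h3 : p ^ k₀ * a = (g k')⁻¹ * (p ^ (k' : ℕ) * a) * φ (g k') := by
      rw [h2, map_inv]; group
    rw [h3] at h1
    rw [← mul_left_inj a, h1, hw]
    simp only [mul_inv_rev, inv_inv, map_mul, map_inv]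
    group
  have hwi : π w⁻¹ = 1 := by rw [map_inv, hw1, inv_one]
  have hpk : ∀ l : ℕ, π (p ^ l) = 1 := fun l => by rw [map_pow, hp, one_pow]
  -- In `f` the contributions of `w` and of `a * φ w⁻¹ * a⁻¹` cancel by invariance, leaving `k * f p
  -- = k' * f p`.
  have := congrArg f e
  rw [hf _ _ (by rw [map_mul, hw1, hpk, one_mul]) (by
    rw [map_mul, map_mul, hφ _ hwi, map_inv, mul_one, mul_inv_cancel]),
    hf _ _ hw1 (hpk _), hinv _ hwi, hf.map_inv hw1, hf.map_pow hp, hf.map_pow hp] at this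
  have h2 : ((k : ℕ) : ℚ) = ((k' : ℕ) : ℚ) := mul_right_cancel₀ hfp (by linarith)
  exact hne (Subtype.ext (by exact_mod_cast h2))

/-! ### The linking cocycle -/

/-- The indicator function of the unordered pair `{p, p + 1}`. -/
def adjIndicator (m p : ℕ) (x : Fin (m + 1) × Fin (m + 1)) : ℚ :=
  if ((x.1 : ℕ) = p ∧ (x.2 : ℕ) = p + 1) ∨ ((x.1 : ℕ) = p + 1 ∧ (x.2 : ℕ) = p) then 1 else 0

/-- The semidirect product of functions on pairs with the symmetric group contains a braid sequence
lifting the adjacent transpositions; the first coordinate of the resulting homomorphism is the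
cocycle. Each crossing counts one half, so that a full twist counts one. -/
theorem exists_linking (m : ℕ) : ∃ l : BraidGroup (m + 1) → Fin (m + 1) × Fin (m + 1) → ℚ,
    (∀ x y z, l (x * y) z = l x z + l y ((braidPerm m x)⁻¹ • z)) ∧
    ∀ p < m, ∀ z, l (sigma m p) z = adjIndicator m p z / 2 := by
  let act : Equiv.Perm (Fin (m + 1)) →* MulAut (Fin (m + 1) × Fin (m + 1) → Multiplicative ℚ) :=
    mulAutArrow
  let s : ℕ → (Fin (m + 1) × Fin (m + 1) → Multiplicative ℚ) ⋊[act] Equiv.Perm (Fin (m + 1)) :=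
    fun p => ⟨fun z => Multiplicative.ofAdd (adjIndicator m p z / 2), adjSwap m p⟩
  have hinv : ∀ p, (adjSwap m p)⁻¹ = adjSwap m p := fun p =>
    inv_eq_of_mul_eq_one_left adjSwap_sq
  have hs : IsBraidSeq m s := by
    constructor
    · intro i hi
      have hi' : i < m := by omega
      refine SemidirectProduct.ext ?_ ((adjSwap_isBraidSeq m).braid i hi)
      funext ⟨a, b⟩
      apply Multiplicative.toAdd.injective
      change adjIndicator m i _ / 2 + adjIndicator m (i + 1) ((adjSwap m i)⁻¹ • (a, b)) / 2 +
        adjIndicator m i ((adjSwap m i * adjSwap m (i + 1))⁻¹ • (a, b)) / 2 =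
        adjIndicator m (i + 1) _ / 2 + adjIndicator m i ((adjSwap m (i + 1))⁻¹ • (a, b)) / 2 +
        adjIndicator m (i + 1) ((adjSwap m (i + 1) * adjSwap m i)⁻¹ • (a, b)) / 2
      simp only [mul_inv_rev, hinv, Prod.smul_mk, Equiv.Perm.smul_def, Equiv.Perm.mul_apply,
        adjIndicator, adjSwap_val hi, adjSwap_val hi']
      generalize (a : ℕ) = x
      generalize (b : ℕ) = y
      have hx : x = i ∨ x = i + 1 ∨ x = i + 2 ∨ (x ≠ i ∧ x ≠ i + 1 ∧ x ≠ i + 2) := by omega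
      have hy : y = i ∨ y = i + 1 ∨ y = i + 2 ∨ (y ≠ i ∧ y ≠ i + 1 ∧ y ≠ i + 2) := by omega
      rcases hx with rfl | rfl | rfl | ⟨h1, h2, h3⟩ <;>
        rcases hy with h | h | h | ⟨h4, h5, h6⟩ <;> (try subst h) <;> simp [*, add_assoc]
    · intro i j hij hj
      have hi' : i < m := by omega
      refine SemidirectProduct.ext ?_ ((adjSwap_isBraidSeq m).comm i j hij hj)
      funext ⟨a, b⟩
      apply Multiplicative.toAdd.injective
      change adjIndicator m i _ / 2 + adjIndicator m j ((adjSwap m i)⁻¹ • (a, b)) / 2 =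
        adjIndicator m j _ / 2 + adjIndicator m i ((adjSwap m j)⁻¹ • (a, b)) / 2
      simp only [hinv, Prod.smul_mk, Equiv.Perm.smul_def,
        adjIndicator, adjSwap_val hj, adjSwap_val hi']
      generalize (a : ℕ) = x
      generalize (b : ℕ) = y
      have e1 : i ≠ j := by omega
      have e2 : i + 1 ≠ j := by omega
      have e3 : i ≠ j + 1 := by omega
      have e1' := e1.symm
      have e2' := e2.symm
      have e3' := e3.symm
      have hx : x = i ∨ x = i + 1 ∨ x = j ∨ x = j + 1 ∨
        (x ≠ i ∧ x ≠ i + 1 ∧ x ≠ j ∧ x ≠ j + 1) := by omega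
      have hy : y = i ∨ y = i + 1 ∨ y = j ∨ y = j + 1 ∨
        (y ≠ i ∧ y ≠ i + 1 ∧ y ≠ j ∧ y ≠ j + 1) := by omega
      clear hi' hj hij
      rcases hx with hx | hx | hx | hx | ⟨h1, h2, h3, h4⟩ <;>
        rcases hy with h | h | h | h | ⟨h5, h6, h7, h8⟩ <;> simp [*]
  obtain ⟨f, hf⟩ := exists_braidLift hs
  have hr : SemidirectProduct.rightHom.comp f = braidPerm m := braidHom_ext fun i hi => by
    rw [braidPerm_sigma hi, MonoidHom.comp_apply, hf i hi]; rfl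
  refine ⟨fun x z => Multiplicative.toAdd ((f x).left z), fun x y z => ?_, fun p hp z => ?_⟩
  · simp only [map_mul, SemidirectProduct.mul_left, ← hr]
    rfl
  · simp only [hf p hp]
    rfl

/-! ### Full twists and linking numbers. -/

/-- The band generator joining two points in any order. -/
def pairArc {G : Type*} [Group G] (s : ℕ → G) (i j : ℕ) : G :=
  if i < j then arc s i (j - i - 1) else arc s j (i - j - 1)

theorem pairArc_comm {G : Type*} [Group G] (s : ℕ → G) {i j : ℕ} :
    pairArc s i j = pairArc s j i := by
  unfold pairArc
  rcases lt_trichotomy i j with h | rfl | h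
  · rw [if_pos h, if_neg (by omega)]
  · rfl
  · rw [if_pos h, if_neg (by omega)]

theorem pairArc_add {G : Type*} [Group G] (s : ℕ → G) (i k : ℕ) :
    pairArc s i (i + k + 1) = arc s i k := by
  rw [pairArc, if_pos (by omega)]
  congr 1
  omega

/-- Conjugation by a generator moves the ends of a band generator, up to conjugation by the square
of that generator. -/
theorem IsBraidSeq.conj_pairArc {G : Type*} [Group G] {m : ℕ} {s : ℕ → G} (hs : IsBraidSeq m s)
    {p i j : ℕ} (hp : p < m) (hi : i ≤ m) (hj : j ≤ m) (hij : i ≠ j) {i' j' : ℕ}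
    (hi' : i' = if i = p then p + 1 else if i = p + 1 then p else i)
    (hj' : j' = if j = p then p + 1 else if j = p + 1 then p else j) :
    s p * pairArc s i j * (s p)⁻¹ = pairArc s i' j' ∨
      s p * pairArc s i j * (s p)⁻¹ = (s p * s p) * pairArc s i' j' * (s p * s p)⁻¹ := by
  wlog h : i < j generalizing i j i' j'
  · rw [pairArc_comm s (i := i), pairArc_comm s (i := i')]
    exact this hj hi hij.symm hj' hi' (by omega)
  obtain ⟨k, rfl⟩ : ∃ k, j = i + k + 1 := ⟨j - i - 1, by omega⟩
  rw [pairArc_add]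
  have hcomm : Commute (s p) (arc s i k) → s p * arc s i k * (s p)⁻¹ = arc s i k := fun hc => by
    rw [hc.eq, mul_inv_cancel_right]
  by_cases h1 : p + 1 < i ∨ i + k + 1 < p
  · left
    rw [hcomm (hs.commute_arc_far (by omega) hp h1)]
    obtain rfl : i' = i := by rw [hi']; split_ifs <;> omega
    obtain rfl : j' = i' + k + 1 := by rw [hj']; split_ifs <;> omega
    rw [pairArc_add]
  by_cases h2 : i < p ∧ p < i + k
  · left
    rw [hcomm (hs.commute_arc_inside (by omega) h2.1 h2.2)]
    obtain rfl : i' = i := by rw [hi']; split_ifs <;> omega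
    obtain rfl : j' = i' + k + 1 := by rw [hj']; split_ifs <;> omega
    rw [pairArc_add]
  by_cases h3 : p = i + k + 1
  · left
    obtain rfl : i' = i := by rw [hi']; split_ifs <;> omega
    obtain rfl : j' = i' + (k + 1) + 1 := by rw [hj']; split_ifs <;> omega
    rw [pairArc_add, h3, ← conj_arc_right]
  by_cases h4 : p + 1 = i
  · right
    obtain rfl : i' = p := by rw [hi']; split_ifs <;> omega
    subst h4
    obtain rfl : j' = i' + (k + 1) + 1 := by rw [hj']; split_ifs <;> omega
    rw [pairArc_add, ← hs.conj_arc_left (by omega)]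
    group
  rcases k with _ | k
  · left
    obtain rfl : p = i := by omega
    obtain rfl : i' = p + 1 := by rw [hi']; split_ifs <;> omega
    obtain hjp : j' = p := by rw [hj']; split_ifs <;> omega
    have e : pairArc s p (p + 1) = s p := pairArc_add s p 0
    rw [pairArc_comm, hjp, e, hcomm (Commute.refl _)]
    rfl
  by_cases h5 : p = i
  · left
    subst h5
    obtain rfl : i' = p + 1 := by rw [hi']; split_ifs <;> omega
    obtain rfl : j' = (p + 1) + k + 1 := by rw [hj']; split_ifs <;> omega
    rw [pairArc_add, ← hs.conj_arc_left (by omega)]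
  · right
    obtain rfl : p = i + k + 1 := by omega
    obtain rfl : i' = i := by rw [hi']; split_ifs <;> omega
    obtain rfl : j' = i' + k + 1 := by rw [hj']; split_ifs <;> omega
    rw [pairArc_add, ← conj_arc_right]
    group

/-- The pure braid in which the strings `i` and `j` make a full twist. -/
def fullTwist (m : ℕ) (i j : Fin (m + 1)) : BraidGroup (m + 1) :=
  pairArc (sigma m) i j * pairArc (sigma m) i j

theorem fullTwist_comm {m : ℕ} (i j : Fin (m + 1)) : fullTwist m i j = fullTwist m j i := by
  rw [fullTwist, pairArc_comm, fullTwist]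

theorem braidPerm_fullTwist {m : ℕ} {i j : Fin (m + 1)} (hij : i ≠ j) :
    braidPerm m (fullTwist m i j) = 1 := by
  wlog h : i < j generalizing i j
  · rw [fullTwist_comm]
    exact this hij.symm (lt_of_le_of_ne (not_lt.1 h) hij.symm)
  have h' : (i : ℕ) < j := h
  obtain ⟨g, -, hg⟩ := IsBraidSeq.exists_conj_arc (s := sigma m) i (j - i - 1) ⊤ (by simp)
  rw [fullTwist, pairArc, if_pos h', hg]
  simp only [map_mul, map_inv, braidPerm_sigma (show (i : ℕ) < m by omega)]
  rw [show ∀ a b : Equiv.Perm (Fin (m + 1)), a * b * a⁻¹ * (a * b * a⁻¹) = a * (b * b) * a⁻¹ from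
    fun a b => by group, adjSwap_sq]
  group

theorem fullTwist_succ {m p : ℕ} (hp : p < m) :
    fullTwist m ⟨p, by omega⟩ ⟨p + 1, by omega⟩ = sigma m p * sigma m p := by
  have e : pairArc (sigma m) p (p + 1) = sigma m p := pairArc_add (sigma m) p 0
  rw [fullTwist]
  change pairArc (sigma m) p (p + 1) * pairArc (sigma m) p (p + 1) = _
  rw [e]

theorem braidPerm_sigma_sq {m p : ℕ} (hp : p < m) :
    braidPerm m (sigma m p * sigma m p) = 1 := by
  rw [map_mul, braidPerm_sigma hp, adjSwap_sq]

namespace AdditiveOnKer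

variable {m : ℕ} {f f' : BraidGroup (m + 1) → ℚ}

/-- A generator moves the ends of a band up to conjugation by a pure braid, which `f` does not see.
The induction must allow `f` to vary, since a product `x * y` uses `f` precomposed with conjugation
by `x`. -/
theorem conj_fullTwist (hf : AdditiveOnKer (braidPerm m) f) (g : BraidGroup (m + 1))
    {i j : Fin (m + 1)} (hij : i ≠ j) :
    f (g * fullTwist m i j * g⁻¹) = f (fullTwist m (braidPerm m g i) (braidPerm m g j)) := by
  induction g using braid_induction generalizing f i j with
  | one => simp
  | gen p hp =>
    have hne : braidPerm m (sigma m p) i ≠ braidPerm m (sigma m p) j := by simpa using hij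
    rcases (sigma_isBraidSeq m).conj_pairArc hp (Nat.lt_succ_iff.1 i.2) (Nat.lt_succ_iff.1 j.2)
      (fun h => hij (Fin.ext h)) rfl rfl with h | h
    · rw [← adjSwap_val hp, ← adjSwap_val hp, ← braidPerm_sigma hp] at h
      rw [fullTwist, fullTwist, ← h]
      congr 1; group
    · rw [← adjSwap_val hp, ← adjSwap_val hp, ← braidPerm_sigma hp] at h
      rw [← hf.conj_eq (braidPerm_sigma_sq hp) (braidPerm_fullTwist hne)]
      congr 1
      have e : sigma m p * fullTwist m i j * (sigma m p)⁻¹ =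
        (sigma m p * pairArc (sigma m) i j * (sigma m p)⁻¹) *
          (sigma m p * pairArc (sigma m) i j * (sigma m p)⁻¹) := by rw [fullTwist]; group
      rw [e, h, fullTwist]
      group
  | mul x y hx hy =>
    have := hy (hf.conj x) hij
    rw [hx hf (by simpa using hij)] at this
    rw [map_mul, Equiv.Perm.mul_apply, Equiv.Perm.mul_apply, ← this]
    congr 1; group
  | inv x hx =>
    obtain ⟨i, rfl⟩ := (braidPerm m x).surjective i
    obtain ⟨j, rfl⟩ := (braidPerm m x).surjective j
    have := hx (hf.conj x⁻¹) (i := i) (j := j) (fun h => hij (by rw [h]))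
    have hinv : ∀ y, (braidPerm m x)⁻¹ (braidPerm m x y) = y :=
      fun y => Equiv.symm_apply_apply _ y
    rw [_root_.map_inv, hinv, hinv, ← this]
    congr 1; group

/-- The values of an additive function on the pure braid group are generated by its values on full
twists. -/
theorem mem_of_fullTwist_mem (hf : AdditiveOnKer (braidPerm m) f) (Z : AddSubgroup ℚ)
    (h : ∀ i j, i ≠ j → f (fullTwist m i j) ∈ Z) {x : BraidGroup (m + 1)}
    (hx : braidPerm m x = 1) : f x ∈ Z := by
  -- Requiring the condition on all conjugates makes `S` normal, so testing the squares of the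
  -- generators suffices.
  let S : Subgroup (BraidGroup (m + 1)) :=
    { carrier := {x | braidPerm m x = 1 ∧ ∀ g, f (g * x * g⁻¹) ∈ Z}
      one_mem' := ⟨_root_.map_one _, fun g => by simp [hf.map_one, Z.zero_mem]⟩
      mul_mem' := fun {x y} hx hy => ⟨by rw [map_mul, hx.1, hy.1, one_mul], fun g => by
        have h1 := hf.conj g x y hx.1 hy.1
        simp only at h1
        rw [h1]
        exact Z.add_mem (hx.2 g) (hy.2 g)⟩
      inv_mem' := fun {x} hx => ⟨by rw [_root_.map_inv, hx.1, inv_one], fun g => by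
        have h1 := (hf.conj g).map_inv hx.1
        rw [h1]
        exact Z.neg_mem (hx.2 g)⟩ }
  have hS : S.Normal := ⟨fun x hx g => ⟨by simp [hx.1], fun g' => by
    have := hx.2 (g' * g)
    simpa [mul_assoc] using this⟩⟩
  have hle : Subgroup.normalClosure {y | ∃ i < m, sigma m i * sigma m i = y} ≤ S := by
    refine Subgroup.normalClosure_le_normal ?_
    rintro _ ⟨i, hi, rfl⟩
    refine ⟨braidPerm_sigma_sq hi, fun g => ?_⟩
    have hne : (⟨i, by omega⟩ : Fin (m + 1)) ≠ ⟨i + 1, by omega⟩ := by simp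
    rw [← fullTwist_succ hi, hf.conj_fullTwist g hne]
    exact h _ _ (by simp)
  simpa using (hle (mem_normalClosure_of_braidPerm_eq_one hx)).2 1

theorem ext_fullTwist (hf : AdditiveOnKer (braidPerm m) f) (hf' : AdditiveOnKer (braidPerm m) f')
    (h : ∀ i j, i ≠ j → f (fullTwist m i j) = f' (fullTwist m i j)) {x : BraidGroup (m + 1)}
    (hx : braidPerm m x = 1) : f x = f' x := by
  have := (hf.add hf' 1 (-1)).mem_of_fullTwist_mem ⊥
    (fun i j hij => by simp [h i j hij]) hx
  rw [AddSubgroup.mem_bot] at this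
  linarith

end AdditiveOnKer

theorem exists_perm_apply_eq {α : Type*} [DecidableEq α] {a b i j : α} (hab : a ≠ b)
    (hij : i ≠ j) : ∃ g : Equiv.Perm α, g a = i ∧ g b = j := by
  set g₁ := Equiv.swap a i with hg₁
  have h1 : a ≠ g₁ j := fun h => hij (by
    have := congrArg g₁ h
    rwa [hg₁, Equiv.swap_apply_left, Equiv.swap_apply_self] at this)
  refine ⟨g₁ * Equiv.swap b (g₁ j), ?_, ?_⟩
  · rw [Equiv.Perm.mul_apply, Equiv.swap_apply_of_ne_of_ne hab h1, hg₁, Equiv.swap_apply_left]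
  · rw [Equiv.Perm.mul_apply, Equiv.swap_apply_left, hg₁, Equiv.swap_apply_self]

/-- The linking numbers of pure braids, as functions of two strings. -/
theorem exists_linkingNumber {m : ℕ} (hm : 0 < m) :
    ∃ l : Fin (m + 1) × Fin (m + 1) → BraidGroup (m + 1) → ℚ,
      (∀ z, AdditiveOnKer (braidPerm m) (l z)) ∧
      (∀ z g x, braidPerm m x = 1 → l z (g * x * g⁻¹) = l ((braidPerm m g)⁻¹ • z) x) ∧
      (∀ i j, i ≠ j → ∀ z, l z (fullTwist m i j) = if z = (i, j) ∨ z = (j, i) then 1 else 0) := by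
  obtain ⟨l, hl, hl0⟩ := exists_linking m
  have h1 : ∀ z, l 1 z = 0 := fun z => by
    have := hl 1 1 z
    simp only [mul_one, map_one, inv_one, one_smul] at this
    linarith
  have hadd : ∀ z, AdditiveOnKer (braidPerm m) (fun x => l x z) := fun z x y hx _ => by
    simp only [hl, hx, inv_one, one_smul]
  have hconj : ∀ z g x, braidPerm m x = 1 →
      l (g * x * g⁻¹) z = l x ((braidPerm m g)⁻¹ • z) := by
    intro z g x hx
    have h2 := hl g g⁻¹ z
    rw [mul_inv_cancel, h1] at h2
    rw [hl, hl, map_mul, hx, mul_one]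
    linarith
  refine ⟨fun z x => l x z, hadd, hconj, ?_⟩
  intro i j hij z
  have h01 : (⟨0, by omega⟩ : Fin (m + 1)) ≠ ⟨0 + 1, by omega⟩ := by simp
  obtain ⟨g, hgi, hgj⟩ := exists_perm_apply_eq h01 hij
  obtain ⟨x, rfl⟩ := braidPerm_surjective m g
  have h3 := (hadd z).conj_fullTwist x h01
  rw [hgi, hgj] at h3
  change l (fullTwist m i j) z = _
  rw [← h3]
  rw [hconj z x _ (braidPerm_fullTwist h01), fullTwist_succ hm, hl, hl0 0 hm, hl0 0 hm,
    braidPerm_sigma hm]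
  have hinv : (adjSwap m 0)⁻¹ = adjSwap m 0 := inv_eq_of_mul_eq_one_left adjSwap_sq
  obtain ⟨w, rfl⟩ : ∃ w, z = braidPerm m x • w := ⟨(braidPerm m x)⁻¹ • z, by simp⟩
  rw [inv_smul_smul, ← hgi, ← hgj, hinv]
  obtain ⟨a, b⟩ := w
  simp only [Prod.smul_mk, Equiv.Perm.smul_def, Prod.mk.injEq, EmbeddingLike.apply_eq_iff_eq,
    adjIndicator, adjSwap_val hm, Fin.ext_iff]
  generalize (a : ℕ) = a
  generalize (b : ℕ) = b
  rcases (by omega : a = 0 ∨ a = 1 ∨ (a ≠ 0 ∧ a ≠ 1)) with rfl | rfl | ⟨h4, h5⟩ <;>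
    rcases (by omega : b = 0 ∨ b = 1 ∨ (b ≠ 0 ∧ b ≠ 1)) with rfl | rfl | ⟨h6, h7⟩ <;> norm_num [*]

/-! ### Traces on the homology of the pure braid group. -/

section LinkingMatrix

variable {m : ℕ} {l : Fin (m + 1) × Fin (m + 1) → BraidGroup (m + 1) → ℚ}

/-- The matrix of the action of an endomorphism preserving the pure braid group on its rational
first homology, padded to be indexed by all pairs of strings. -/
def linkingMatrix (l : Fin (m + 1) × Fin (m + 1) → BraidGroup (m + 1) → ℚ)
    (ψ : BraidGroup (m + 1) →* BraidGroup (m + 1)) :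
    Matrix (Fin (m + 1) × Fin (m + 1)) (Fin (m + 1) × Fin (m + 1)) ℚ :=
  fun p q => if q.1 ≠ q.2 then l p (ψ (fullTwist m q.1 q.2)) / 2 else 0

/-- Both sides are additive and agree on full twists. The halving is needed because the sum meets
each unordered pair twice. -/
theorem eq_sum_linking (hl : ∀ z, AdditiveOnKer (braidPerm m) (l z))
    (hl' : ∀ i j, i ≠ j → ∀ z, l z (fullTwist m i j) = if z = (i, j) ∨ z = (j, i) then 1 else 0)
    {f : BraidGroup (m + 1) → ℚ} (hf : AdditiveOnKer (braidPerm m) f) {x : BraidGroup (m + 1)}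
    (hx : braidPerm m x = 1) :
    f x = ∑ q : Fin (m + 1) × Fin (m + 1),
      (if q.1 ≠ q.2 then f (fullTwist m q.1 q.2) / 2 else 0) * l q x := by
  refine AdditiveOnKer.ext_fullTwist (f' := fun x => ∑ q : Fin (m + 1) × Fin (m + 1),
      (if q.1 ≠ q.2 then f (fullTwist m q.1 q.2) / 2 else 0) * l q x) hf ?_ ?_ hx
  · intro y z hy hz
    simp only [hl _ y z hy hz, mul_add, Finset.sum_add_distrib]
  · intro i j hij
    have hne : ((i, j) : Fin (m + 1) × Fin (m + 1)) ≠ (j, i) := fun h =>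
      hij (congrArg Prod.fst h)
    rw [← Finset.sum_subset (Finset.subset_univ {(i, j), (j, i)}), Finset.sum_pair hne]
    · simp only [hl' i j hij, ne_eq, hij, hij.symm, not_false_eq_true, if_true, true_or, or_true]
      rw [fullTwist_comm j i]
      ring
    · intro q _ hq
      have hq' : ¬ (q = (i, j) ∨ q = (j, i)) := by simpa using hq
      rw [hl' i j hij, if_neg hq', mul_zero]

theorem linkingMatrix_comp (hl : ∀ z, AdditiveOnKer (braidPerm m) (l z))
    (hl' : ∀ i j, i ≠ j → ∀ z, l z (fullTwist m i j) = if z = (i, j) ∨ z = (j, i) then 1 else 0)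
    {ψ ψ' : BraidGroup (m + 1) →* BraidGroup (m + 1)}
    (hψ : ∀ x, braidPerm m x = 1 → braidPerm m (ψ x) = 1)
    (hψ' : ∀ x, braidPerm m x = 1 → braidPerm m (ψ' x) = 1) :
    linkingMatrix l (ψ.comp ψ') = linkingMatrix l ψ * linkingMatrix l ψ' := by
  ext p q
  rw [Matrix.mul_apply]
  by_cases hq : q.1 ≠ q.2
  · have := eq_sum_linking hl hl' ((hl p).comp_hom ψ hψ) (hψ' _ (braidPerm_fullTwist hq))
    simp only [linkingMatrix, if_pos hq, MonoidHom.comp_apply]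
    rw [this, Finset.sum_div]
    exact Finset.sum_congr rfl fun r _ => by ring
  · simp only [linkingMatrix, if_neg hq, mul_zero, Finset.sum_const_zero]

/-- Conjugation permutes the classes of full twists, so twice the trace counts the ordered pairs of
distinct strings that the involution fixes or exchanges: pairs of fixed points, and one pair for
each moved point. -/
theorem trace_linkingMatrix_conj
    (hl' : ∀ i j, i ≠ j → ∀ z, l z (fullTwist m i j) = if z = (i, j) ∨ z = (j, i) then 1 else 0)
    (hconj : ∀ z g x, braidPerm m x = 1 → l z (g * x * g⁻¹) = l ((braidPerm m g)⁻¹ • z) x)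
    {g : BraidGroup (m + 1)} (hg : braidPerm m g * braidPerm m g = 1) :
    2 * (linkingMatrix l (MulAut.conj g).toMonoidHom).trace =
      (m + 1 - (braidPerm m g).support.card) * (m - (braidPerm m g).support.card) +
        (braidPerm m g).support.card := by
  set t := braidPerm m g with ht
  have hinv : t⁻¹ = t := inv_eq_of_mul_eq_one_left hg
  have htt : ∀ i, t (t i) = i := fun i => DFunLike.congr_fun hg i
  have hentry : ∀ i j, 2 * linkingMatrix l (MulAut.conj g).toMonoidHom (i, j) (i, j) =
      if i ≠ j ∧ ((t i = i ∧ t j = j) ∨ (t i = j ∧ t j = i)) then 1 else 0 := by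
    intro i j
    by_cases hij : i = j
    · simp [linkingMatrix, hij]
    · have : l (i, j) ((MulAut.conj g).toMonoidHom (fullTwist m i j)) =
          if (t i = i ∧ t j = j) ∨ (t i = j ∧ t j = i) then 1 else 0 := by
        change l (i, j) (g * fullTwist m i j * g⁻¹) = _
        rw [hconj _ _ _ (braidPerm_fullTwist hij), hl' i j hij, ← ht, hinv]
        simp only [Prod.smul_mk, Equiv.Perm.smul_def, Prod.mk.injEq]
      simp only [linkingMatrix, if_pos (show i ≠ j from hij), this]
      simp only [ne_eq, hij, not_false_eq_true, true_and]
      ring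
  have hsupp : ((Finset.univ.filter fun j => t j = j).card : ℚ) = m + 1 - t.support.card := by
    have h1 := Finset.card_filter_add_card_filter_not (s := (Finset.univ : Finset (Fin (m + 1))))
      (fun j => t j = j)
    have h2 : (Finset.univ.filter fun j => ¬ t j = j) = t.support := by
      ext j; simp
    rw [h2, Finset.card_univ, Fintype.card_fin] at h1
    have h3 : ((Finset.univ.filter fun j => t j = j).card : ℚ) + t.support.card = m + 1 := by
      exact_mod_cast h1
    linarith
  have hrow : ∀ i, ∑ j, (if i ≠ j ∧ ((t i = i ∧ t j = j) ∨ (t i = j ∧ t j = i)) then (1 : ℚ) else 0)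
      = if t i = i then (m - t.support.card : ℚ) else 1 := by
    intro i
    rw [Finset.sum_boole]
    split_ifs with h
    · have : (Finset.univ.filter fun j => i ≠ j ∧ ((t i = i ∧ t j = j) ∨ (t i = j ∧ t j = i))) =
          (Finset.univ.filter fun j => t j = j).erase i := by
        ext j
        simp only [Finset.mem_filter, Finset.mem_univ, true_and, Finset.mem_erase, h]
        constructor
        · rintro ⟨h1, h2 | h2⟩
          · exact ⟨Ne.symm h1, h2⟩
          · exact absurd h2.1 h1
        · exact fun h' => ⟨Ne.symm h'.1, Or.inl h'.2⟩
      have hpos : 1 ≤ (Finset.univ.filter fun j => t j = j).card :=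
        Finset.card_pos.2 ⟨i, by simpa using h⟩
      rw [this, Finset.card_erase_of_mem (by simpa using h), Nat.cast_sub hpos, hsupp]
      push_cast; ring
    · have : (Finset.univ.filter fun j => i ≠ j ∧ ((t i = i ∧ t j = j) ∨ (t i = j ∧ t j = i))) =
          {t i} := by
        ext j
        simp only [Finset.mem_filter, Finset.mem_univ, true_and, Finset.mem_singleton, h, false_and,
          false_or]
        constructor
        · exact fun h' => h'.2.1.symm
        · rintro rfl
          exact ⟨Ne.symm h, rfl, htt i⟩
      rw [this]; simp
  rw [Matrix.trace, Finset.mul_sum, Fintype.sum_prod_type]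
  simp only [Matrix.diag, hentry, hrow]
  rw [Finset.sum_ite, Finset.sum_const, Finset.sum_const, nsmul_eq_mul, nsmul_eq_mul, hsupp]
  have h2 : (Finset.univ.filter fun j => ¬ t j = j) = t.support := by
    ext j; simp
  rw [h2]; ring

end LinkingMatrix

/-- Automorphisms of the braid group send the generators to braids inducing transpositions. -/
theorem isSwap_braidPerm_aut {m : ℕ} (hm : 4 ≤ m) (φ : BraidGroup (m + 1) ≃* BraidGroup (m + 1))
    {p : ℕ} (hp : p < m) : (braidPerm m (φ (sigma m p))).IsSwap := by
  obtain ⟨l, hl, hconj, hl'⟩ := exists_linkingNumber (m := m) (by omega)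
  have hφ := fun x => braidPerm_aut_eq_one (Or.inr hm) φ (x := x)
  have hφ' := fun x => braidPerm_aut_eq_one (Or.inr hm) φ.symm (x := x)
  have hc : ∀ g x, braidPerm m x = 1 → braidPerm m ((MulAut.conj g).toMonoidHom x) = 1 := by
    intro g x hx
    change braidPerm m (g * x * g⁻¹) = 1
    simp [hx]
  have e1 : (MulAut.conj (φ (sigma m p))).toMonoidHom =
      φ.toMonoidHom.comp ((MulAut.conj (sigma m p)).toMonoidHom.comp φ.symm.toMonoidHom) := by
    refine MonoidHom.ext fun x => ?_
    change φ (sigma m p) * x * (φ (sigma m p))⁻¹ = φ (sigma m p * φ.symm x * (sigma m p)⁻¹)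
    simp
  have e2 : (MulAut.conj (sigma m p)).toMonoidHom =
      ((MulAut.conj (sigma m p)).toMonoidHom.comp φ.symm.toMonoidHom).comp φ.toMonoidHom := by
    refine MonoidHom.ext fun x => ?_
    change sigma m p * x * (sigma m p)⁻¹ = sigma m p * φ.symm (φ x) * (sigma m p)⁻¹
    simp
  have hcomp : ∀ x, braidPerm m x = 1 → braidPerm m
      (((MulAut.conj (sigma m p)).toMonoidHom.comp φ.symm.toMonoidHom) x) = 1 :=
    fun x hx => hc _ _ (hφ' x hx)
  -- Conjugation by `φ (sigma m p)` is conjugation by `sigma m p` transported along `φ`, so the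
  -- traces agree.
  have htr : (linkingMatrix l (MulAut.conj (φ (sigma m p))).toMonoidHom).trace =
      (linkingMatrix l (MulAut.conj (sigma m p)).toMonoidHom).trace := by
    rw [e1, linkingMatrix_comp hl hl' (ψ := φ.toMonoidHom) hφ hcomp, Matrix.trace_mul_comm,
      ← linkingMatrix_comp hl hl' (ψ' := φ.toMonoidHom) hcomp hφ, ← e2]
  have h1 := trace_linkingMatrix_conj hl' hconj (g := sigma m p)
    (by rw [← map_mul, braidPerm_sigma_sq hp])
  have h2 := trace_linkingMatrix_conj hl' hconj (g := φ (sigma m p))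
    (by rw [← map_mul, ← map_mul]; exact hφ _ (braidPerm_sigma_sq hp))
  have h3 : (braidPerm m (sigma m p)).support.card = 2 := by
    rw [braidPerm_sigma hp, adjSwap, dif_pos hp]
    exact Equiv.Perm.card_support_swap (by simp)
  rw [htr, h1, h3] at h2
  rw [← Equiv.Perm.card_support_eq_two]
  set S := (braidPerm m (φ (sigma m p))).support.card with hS
  have hSle : S ≤ m + 1 := by
    have := Finset.card_le_univ (braidPerm m (φ (sigma m p))).support
    rwa [Fintype.card_fin] at this
  -- Equating the trace with that of a transposition gives a quadratic in `S` with second root `2 *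
  -- m - 2`, which exceeds `m + 1` when `m ≥ 4`.
  have h4 : ((S : ℚ) - 2) * (S - (2 * m - 2)) = 0 := by push_cast at h2; linarith
  rcases mul_eq_zero.1 h4 with h5 | h5
  · have : (S : ℚ) = 2 := by linarith
    exact_mod_cast this
  · have h6 : (S : ℚ) = 2 * m - 2 := by linarith
    have h7 : (S : ℚ) ≤ m + 1 := by exact_mod_cast hSle
    have h8 : (4 : ℚ) ≤ m := by exact_mod_cast hm
    linarith

/-! ### Five or more strings: the alternating line. -/

section

variable {m : ℕ}

/-- Additive functions on the pure braid group which change sign under the first generator and are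
invariant under the generators commuting with it. -/
structure IsAlternating (m : ℕ) (f : BraidGroup (m + 1) → ℚ) : Prop where
  additive : AdditiveOnKer (braidPerm m) f
  neg : ∀ x, braidPerm m x = 1 → f (sigma m 0 * x * (sigma m 0)⁻¹) = - f x
  inv : ∀ p, 2 ≤ p → p < m → ∀ x, braidPerm m x = 1 →
    f (sigma m p * x * (sigma m p)⁻¹) = f x

/-- Invariance under later generators identifies all twists of string `0` with strings from `2` on;
the sign rule gives those of string `1` and kills every twist whose pair is preserved by the first
transposition. Thus one value determines `f`. -/
theorem IsAlternating.apply_fullTwist {f : BraidGroup (m + 1) → ℚ} (hf : IsAlternating m f)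
    (hm : 2 ≤ m) {i j : ℕ} (hij : i < j) (hj : j < m + 1) :
    f (fullTwist m ⟨i, by omega⟩ ⟨j, hj⟩) = f (fullTwist m ⟨0, by omega⟩ ⟨2, by omega⟩) *
      (if 2 ≤ j then if i = 0 then 1 else if i = 1 then -1 else 0 else 0) := by
  have hneg : ∀ i j i' j' : Fin (m + 1), i ≠ j → adjSwap m 0 i = i' → adjSwap m 0 j = j' →
      f (fullTwist m i' j') = - f (fullTwist m i j) := by
    rintro i j _ _ h rfl rfl
    rw [← hf.neg _ (braidPerm_fullTwist h), hf.additive.conj_fullTwist _ h,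
      braidPerm_sigma (by omega)]
  have hinv : ∀ p, 2 ≤ p → p < m → ∀ i j i' j' : Fin (m + 1), i ≠ j → adjSwap m p i = i' →
      adjSwap m p j = j' → f (fullTwist m i' j') = f (fullTwist m i j) := by
    rintro p hp hpm i j _ _ h rfl rfl
    rw [← hf.inv p hp hpm _ (braidPerm_fullTwist h), hf.additive.conj_fullTwist _ h,
      braidPerm_sigma hpm]
  have hval : ∀ p, p < m → ∀ (a : ℕ) (ha : a < m + 1) (b : ℕ) (hb : b < m + 1),
      (b = if a = p then p + 1 else if a = p + 1 then p else a) →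
      adjSwap m p ⟨a, ha⟩ = ⟨b, hb⟩ := by
    intro p hp a ha b hb h
    apply Fin.ext
    rw [adjSwap_val hp]
    exact h.symm
  have h0 : ∀ j, 2 ≤ j → ∀ hj : j < m + 1, f (fullTwist m ⟨0, by omega⟩ ⟨j, hj⟩) =
      f (fullTwist m ⟨0, by omega⟩ ⟨2, by omega⟩) := by
    intro j h2
    induction j, h2 using Nat.le_induction with
    | base => exact fun _ => rfl
    | succ j h2 ih =>
      intro hj
      rw [← ih (by omega)]
      refine hinv j h2 (by omega) _ _ _ _ (fun h => ?_) (hval j (by omega) _ _ _ _ ?_)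
        (hval j (by omega) _ _ _ _ ?_)
      · have := congrArg Fin.val h
        simp only at this
        omega
      · rw [if_neg (by omega), if_neg (by omega)]
      · split_ifs <;> omega
  by_cases hj2 : 2 ≤ j
  · rw [if_pos hj2]
    rcases i with _ | _ | i
    · simpa using h0 j hj2 hj
    · have := hneg ⟨0, by omega⟩ ⟨j, hj⟩ ⟨1, by omega⟩ ⟨j, hj⟩ (fun h => by
        have := congrArg Fin.val h
        simp only at this
        omega) (hval 0 (by omega) _ _ _ _ (by simp))
        (hval 0 (by omega) _ _ _ _ (by split_ifs <;> omega))
      rw [h0 j hj2 hj] at this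
      simpa using this
    · have := hneg ⟨i + 2, by omega⟩ ⟨j, hj⟩ ⟨i + 2, by omega⟩ ⟨j, hj⟩ (fun h => by
        have := congrArg Fin.val h
        simp only at this
        omega) (hval 0 (by omega) _ _ _ _ (by rw [if_neg (by omega), if_neg (by omega)]))
        (hval 0 (by omega) _ _ _ _ (by split_ifs <;> omega))
      have h' : f (fullTwist m ⟨i + 2, by omega⟩ ⟨j, hj⟩) = 0 := by linarith
      simpa using h'
  · obtain rfl : j = 1 := by omega
    obtain rfl : i = 0 := by omega
    have := hneg ⟨0, by omega⟩ ⟨1, by omega⟩ ⟨1, by omega⟩ ⟨0, by omega⟩ (by simp)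
      (hval 0 (by omega) _ _ _ _ (by simp)) (hval 0 (by omega) _ _ _ _ (by simp))
    rw [fullTwist_comm] at this
    have h' : f (fullTwist m ⟨0, by omega⟩ ⟨1, by omega⟩) = 0 := by linarith
    simpa using h'

theorem IsAlternating.proportional {f f' : BraidGroup (m + 1) → ℚ} (hf : IsAlternating m f)
    (hf' : IsAlternating m f') (hm : 2 ≤ m) {x : BraidGroup (m + 1)} (hx : braidPerm m x = 1) :
    f' (fullTwist m ⟨0, by omega⟩ ⟨2, by omega⟩) * f x =
      f (fullTwist m ⟨0, by omega⟩ ⟨2, by omega⟩) * f' x := by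
  have := AdditiveOnKer.ext_fullTwist
    (hf.additive.add hf'.additive (f' (fullTwist m ⟨0, by omega⟩ ⟨2, by omega⟩)) 0)
    (hf.additive.add hf'.additive 0 (f (fullTwist m ⟨0, by omega⟩ ⟨2, by omega⟩))) ?_ hx
  · simpa using this
  · intro i j hij
    wlog h : i < j generalizing i j
    · rw [fullTwist_comm i j]
      exact this j i hij.symm (lt_of_le_of_ne (not_lt.1 h) hij.symm)
    have h1 := hf.apply_fullTwist hm (i := i) (j := j) h j.2
    have h2 := hf'.apply_fullTwist hm (i := i) (j := j) h j.2
    simp only [Fin.eta] at h1 h2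
    simp only [h1, h2]
    ring

theorem exists_isAlternating (hm : 2 ≤ m) : ∃ f : BraidGroup (m + 1) → ℚ,
    AdditiveOnKer (braidPerm m) f ∧ f (fullTwist m ⟨0, by omega⟩ ⟨2, by omega⟩) = 1 ∧
    (∀ x, braidPerm m x = 1 → ∃ k : ℤ, (k : ℚ) = f x) ∧
    (∀ g x, braidPerm m x = 1 → braidPerm m g ⟨0, by omega⟩ = ⟨0, by omega⟩ →
      braidPerm m g ⟨1, by omega⟩ = ⟨1, by omega⟩ → f (g * x * g⁻¹) = f x) ∧
    (∀ g x, braidPerm m x = 1 → braidPerm m g = adjSwap m 0 → f (g * x * g⁻¹) = - f x) := by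
  obtain ⟨l, hl, hconj, hl'⟩ := exists_linkingNumber (m := m) (by omega)
  set a : Fin (m + 1) := ⟨0, by omega⟩ with ha
  set b : Fin (m + 1) := ⟨1, by omega⟩ with hb
  have hab : a ≠ b := by simp [ha, hb]
  -- The total linking of string `0` minus that of string `1`; their mutual linking cancels.
  set f : BraidGroup (m + 1) → ℚ := fun x => ∑ j, l (a, j) x - ∑ j, l (b, j) x with hf
  have hadd : AdditiveOnKer (braidPerm m) f := by
    intro x y hx hy
    simp only [hf, hl _ x y hx hy, Finset.sum_add_distrib]
    ring
  have hfc : ∀ g x, braidPerm m x = 1 → f (g * x * g⁻¹) =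
      ∑ j, l ((braidPerm m g)⁻¹ a, j) x - ∑ j, l ((braidPerm m g)⁻¹ b, j) x := by
    intro g x hx
    simp only [hf, hconj _ g x hx, Prod.smul_mk, Equiv.Perm.smul_def]
    congr 1
    · exact Equiv.sum_comp (braidPerm m g)⁻¹ (fun j => l ((braidPerm m g)⁻¹ a, j) x)
    · exact Equiv.sum_comp (braidPerm m g)⁻¹ (fun j => l ((braidPerm m g)⁻¹ b, j) x)
  refine ⟨f, hadd, ?_, ?_, ?_, ?_⟩
  · have h02 : a ≠ ⟨2, by omega⟩ := by simp [ha]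
    have hne : b ≠ (⟨2, by omega⟩ : Fin (m + 1)) := by simp [hb]
    simp only [hf, hl' _ _ h02, Prod.mk.injEq, hab.symm, hne, h02, false_and, true_and, or_self,
      if_false, Finset.sum_const_zero, sub_zero, or_false]
    simp
  · intro x hx
    have := hadd.mem_of_fullTwist_mem (Int.castAddHom ℚ).range (fun i j hij => by
      simp only [hf, hl' i j hij]
      refine AddSubgroup.sub_mem _ (AddSubgroup.sum_mem _ fun k _ => ?_)
        (AddSubgroup.sum_mem _ fun k _ => ?_) <;>
      · split_ifs
        · exact ⟨1, by simp⟩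
        · exact AddSubgroup.zero_mem _) hx
    obtain ⟨k, hk⟩ := this
    exact ⟨k, by simpa using hk⟩
  · intro g x hx h0 h1
    have h0' : (braidPerm m g)⁻¹ a = a := by rw [Equiv.Perm.inv_eq_iff_eq, h0]
    have h1' : (braidPerm m g)⁻¹ b = b := by rw [Equiv.Perm.inv_eq_iff_eq, h1]
    rw [hfc g x hx, h0', h1']
  · intro g x hx hg
    have h0 : adjSwap m 0 b = a := by
      apply Fin.ext; rw [adjSwap_val (by omega)]; simp [ha, hb]
    have h1 : adjSwap m 0 a = b := by
      apply Fin.ext; rw [adjSwap_val (by omega)]; simp [ha, hb]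
    have h0' : (braidPerm m g)⁻¹ a = b := by rw [Equiv.Perm.inv_eq_iff_eq, hg, h0]
    have h1' : (braidPerm m g)⁻¹ b = a := by rw [Equiv.Perm.inv_eq_iff_eq, hg, h1]
    rw [hfc g x hx, h0', h1']
    simp only [hf]; ring

theorem fixes_of_isSwap_of_commute {α : Type*} [DecidableEq α] {a b : α} (hab : a ≠ b)
    {t : Equiv.Perm α} (ht : t.IsSwap) (hne : t ≠ Equiv.swap a b)
    (hc : t * Equiv.swap a b = Equiv.swap a b * t) : t a = a ∧ t b = b := by
  have h1 : t b = Equiv.swap a b (t a) := by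
    have := DFunLike.congr_fun hc a
    simpa using this
  have h2 : t a = Equiv.swap a b (t b) := by rw [h1, Equiv.swap_apply_self]
  by_cases hta : t a = a
  · exact ⟨hta, by rw [h1, hta, Equiv.swap_apply_left]⟩
  exfalso
  by_cases htb : t a = b
  · obtain ⟨c, d, hcd, rfl⟩ := ht
    apply hne
    rw [Equiv.swap_apply_def] at htb
    split_ifs at htb with h3 h4
    · rw [h3, htb]
    · rw [h4, htb, Equiv.swap_comm]
    · exact absurd htb hab
  · rw [Equiv.swap_apply_of_ne_of_ne hta htb] at h1
    exact hab (t.injective h1.symm)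

theorem reidemeisterNumber_braid_of_four_le (hm : 4 ≤ m)
    (φ : BraidGroup (m + 1) ≃* BraidGroup (m + 1)) : reidemeisterNumber φ = ⊤ := by
  set a : Fin (m + 1) := ⟨0, by omega⟩ with ha
  set b : Fin (m + 1) := ⟨1, by omega⟩ with hb
  have hab : a ≠ b := by simp [ha, hb]
  have hs0 : adjSwap m 0 = Equiv.swap a b := by
    rw [adjSwap, dif_pos (by omega)]
  obtain ⟨f, hadd, hf1, hfZ, hfix, hneg⟩ := exists_isAlternating (m := m) (by omega)
  have hpres : ∀ (ψ : BraidGroup (m + 1) ≃* BraidGroup (m + 1)) x, braidPerm m x = 1 →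
      braidPerm m (ψ x) = 1 := fun ψ x => braidPerm_aut_eq_one (Or.inr hm) ψ
  have hbp : ∀ p, 2 ≤ p → p < m → adjSwap m p a = a ∧ adjSwap m p b = b := by
    intro p h2 hp
    constructor <;> apply Fin.ext <;> rw [adjSwap_val hp] <;>
      rw [if_neg (by simp only [ha, hb]; omega), if_neg (by simp only [ha, hb]; omega)]
  have hfalt : IsAlternating m f :=
    ⟨hadd, fun x hx => hneg _ x hx (braidPerm_sigma (by omega)), fun p h2 hp x hx =>
      hfix _ x hx (by rw [braidPerm_sigma hp]; exact (hbp p h2 hp).1)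
        (by rw [braidPerm_sigma hp]; exact (hbp p h2 hp).2)⟩
  have key : ∀ ψ : BraidGroup (m + 1) ≃* BraidGroup (m + 1),
      braidPerm m (ψ (sigma m 0)) = adjSwap m 0 →
      ∃ k : ℤ, ∀ x, braidPerm m x = 1 → f (ψ x) = k * f x := by
    intro ψ hψ
    have halt : IsAlternating m (fun x => f (ψ x)) := by
      refine ⟨hadd.comp_hom ψ.toMonoidHom (hpres ψ), fun x hx => ?_, fun p h2 hp x hx => ?_⟩
      · simp only [map_mul, map_inv]
        exact hneg _ _ (hpres ψ x hx) hψ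
      · simp only [map_mul, map_inv]
        have hc : braidPerm m (ψ (sigma m p)) * Equiv.swap a b =
            Equiv.swap a b * braidPerm m (ψ (sigma m p)) := by
          rw [← hs0, ← hψ, ← map_mul, ← map_mul, ← map_mul, ← map_mul,
            (sigma_isBraidSeq m).comm 0 p (by omega) hp]
        have hne : braidPerm m (ψ (sigma m p)) ≠ Equiv.swap a b := by
          intro h
          -- If both generators induced the same transposition, their quotient would have pure image
          -- under `ψ` and so be pure itself.
          have h3 : braidPerm m (ψ (sigma m p * (sigma m 0)⁻¹)) = 1 := by
            rw [map_mul, map_mul, map_inv, map_inv, h, hψ, hs0, mul_inv_cancel]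
          have h4 := hpres ψ.symm _ h3
          rw [MulEquiv.symm_apply_apply, map_mul, map_inv, mul_inv_eq_one, braidPerm_sigma hp,
            braidPerm_sigma (by omega), hs0] at h4
          have h5 := (hbp p h2 hp).1
          rw [h4, Equiv.swap_apply_left] at h5
          exact hab h5.symm
        obtain ⟨h6, h7⟩ := fixes_of_isSwap_of_commute hab (isSwap_braidPerm_aut hm ψ hp) hne hc
        exact hfix _ _ (hpres ψ x hx) h6 h7
    have h02 : a ≠ ⟨2, by omega⟩ := by simp [ha]
    obtain ⟨k, hk⟩ := hfZ _ (hpres ψ _ (braidPerm_fullTwist h02))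
    refine ⟨k, fun x hx => ?_⟩
    have := halt.proportional hfalt (by omega) hx
    rw [hf1, one_mul] at this
    rw [this, hk]
  obtain ⟨c, d, hcd, hsw⟩ := isSwap_braidPerm_aut hm φ (p := 0) (by omega)
  obtain ⟨g₀, hgc, hgd⟩ := exists_perm_apply_eq hcd hab
  obtain ⟨g, rfl⟩ := braidPerm_surjective m g₀
  set ψ : BraidGroup (m + 1) ≃* BraidGroup (m + 1) := φ.trans (MulAut.conj g) with hψ
  have hψx : ∀ x, ψ x = g * φ x * g⁻¹ := fun x => rfl
  have hψ0 : braidPerm m (ψ (sigma m 0)) = adjSwap m 0 := by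
    rw [hψx, map_mul, map_mul, map_inv, hsw, hs0, ← hgc, ← hgd, Equiv.swap_apply_apply]
  have hψ0' : braidPerm m (ψ.symm (sigma m 0)) = adjSwap m 0 := by
    have h1 : braidPerm m (ψ (sigma m 0) * (sigma m 0)⁻¹) = 1 := by
      rw [map_mul, map_inv, hψ0, braidPerm_sigma (by omega), mul_inv_cancel]
    have h2 := hpres ψ.symm _ h1
    rw [map_mul, MulEquiv.symm_apply_apply, map_mul, map_inv, map_inv, mul_inv_eq_one,
      braidPerm_sigma (by omega)] at h2
    exact h2.symm
  obtain ⟨k, hk⟩ := key ψ hψ0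
  obtain ⟨k', hk'⟩ := key ψ.symm hψ0'
  have h02 : a ≠ ⟨2, by omega⟩ := by simp [ha]
  have hp := braidPerm_fullTwist h02
  -- The scalars of `ψ` and of its inverse are integers, so each is a sign.
  have hkk : k * k' = 1 := by
    have h1 := hk _ (hpres ψ.symm _ hp)
    rw [MulEquiv.apply_symm_apply, hk' _ hp, hf1, mul_one] at h1
    exact_mod_cast h1.symm
  have hfp : f (fullTwist m a ⟨2, by omega⟩) ≠ 0 := by rw [hf1]; exact one_ne_zero
  rcases Int.eq_one_or_neg_one_of_mul_eq_one hkk with rfl | rfl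
  · refine reidemeisterNumber_eq_top (braidPerm m) φ (hpres φ) g (Set.toFinite _) hadd
      (fun x hx => ?_) hp hfp
    rw [← hψx, hk x hx]; simp
  -- A further conjugation by the first generator changes the sign of `f` and cancels the scalar
  -- `-1`.
  · refine reidemeisterNumber_eq_top (braidPerm m) φ (hpres φ) (sigma m 0 * g) (Set.toFinite _)
      hadd (fun x hx => ?_) hp hfp
    have e : sigma m 0 * g * φ x * (sigma m 0 * g)⁻¹ = sigma m 0 * ψ x * (sigma m 0)⁻¹ := by
      rw [hψx]; group
    rw [e, hneg _ _ (hpres ψ x hx) (braidPerm_sigma (by omega)), hk x hx]; simp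

end

/-! ### Three and four strings: the kernel of the exponent sum. -/

section

variable {m : ℕ}

theorem const_isBraidSeq {G : Type*} [Group G] (m : ℕ) (g : G) : IsBraidSeq m (fun _ => g) :=
  ⟨fun _ _ => rfl, fun _ _ _ _ => rfl⟩

/-- The exponent sum of a braid. -/
noncomputable def expSum (m : ℕ) : BraidGroup (m + 1) →* Multiplicative ℤ :=
  (exists_braidLift (const_isBraidSeq m (Multiplicative.ofAdd (1 : ℤ)))).choose

theorem expSum_sigma {i : ℕ} (h : i < m) : expSum m (sigma m i) = Multiplicative.ofAdd 1 :=
  (exists_braidLift (const_isBraidSeq m (Multiplicative.ofAdd (1 : ℤ)))).choose_spec i h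

theorem exists_expSum_aut (φ : BraidGroup (m + 1) ≃* BraidGroup (m + 1)) :
    ∃ q : ℤ, ∀ x, expSum m (φ x) = expSum m x ^ q := by
  obtain ⟨q, hq⟩ : ∃ q : ℤ, expSum m (φ (sigma m 0)) = Multiplicative.ofAdd q := ⟨_, rfl⟩
  refine ⟨q, fun x => ?_⟩
  have : (expSum m).comp φ.toMonoidHom = (zpowGroupHom q).comp (expSum m) := by
    refine braidHom_ext fun i hi => ?_
    obtain ⟨g, -, hg⟩ := (sigma_isBraidSeq m).exists_conj_term hi ⊤ (by simp)
    change expSum m (φ (sigma m i)) = expSum m (sigma m i) ^ q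
    rw [expSum_sigma hi, hg]
    simp only [map_mul, map_inv, mul_inv_cancel_comm]
    rw [← ofAdd_zsmul, hq]
    simp
  exact DFunLike.congr_fun this x

theorem expSum_aut (hm : 0 < m) (φ : BraidGroup (m + 1) ≃* BraidGroup (m + 1)) :
    (∀ x, expSum m (φ x) = expSum m x) ∨ (∀ x, expSum m (φ x) = (expSum m x)⁻¹) := by
  obtain ⟨q, hq⟩ := exists_expSum_aut φ
  obtain ⟨q', hq'⟩ := exists_expSum_aut φ.symm
  have h := hq (φ.symm (sigma m 0))
  rw [MulEquiv.apply_symm_apply, hq', expSum_sigma hm, ← zpow_mul, ← ofAdd_zsmul] at h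
  have h' : q' * q = 1 := by simpa using (Multiplicative.ofAdd.injective h).symm
  rcases Int.eq_one_or_neg_one_of_mul_eq_one (mul_comm q q' ▸ h') with rfl | rfl
  · exact Or.inl fun x => by rw [hq, zpow_one]
  · exact Or.inr fun x => by rw [hq, zpow_neg_one]

/-- The exponent sum is a fixed additive function on the whole group, so the trivial quotient serves
as `Q`. -/
theorem reidemeisterNumber_of_expSum_eq (hm : 0 < m)
    (φ : BraidGroup (m + 1) ≃* BraidGroup (m + 1)) (h : ∀ x, expSum m (φ x) = expSum m x) :
    reidemeisterNumber φ = ⊤ := by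
  refine reidemeisterNumber_eq_top (Q := PUnit.{1}) 1 φ (fun x _ => rfl) 1 (Set.toFinite _)
    (f := fun x => (Multiplicative.toAdd (expSum m x) : ℤ)) ?_ (fun x _ => ?_) (p := sigma m 0) rfl
    ?_
  · intro x y _ _
    simp
  · simp [h]
  · simp [expSum_sigma hm]

namespace AdditiveOnKer

variable {f f' : BraidGroup (m + 1) → ℚ}

theorem conj_eq_of_expSum_eq (hf : AdditiveOnKer (expSum m) f) {g h x : BraidGroup (m + 1)}
    (hgh : expSum m g = expSum m h) (hx : expSum m x = 1) :
    f (g * x * g⁻¹) = f (h * x * h⁻¹) := by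
  have h1 : expSum m (g * h⁻¹) = 1 := by rw [map_mul, _root_.map_inv, hgh, mul_inv_cancel]
  have h2 : expSum m (h * x * h⁻¹) = 1 := by simp [hx]
  rw [← hf.conj_eq h1 h2]
  congr 1; group

/-- With `t = sigma m 0` and `u = sigma m 1 * t⁻¹`, the braid relation reads `t u t⁻¹ = u * (t² u
t⁻²)`. Additively, conjugation by `t` satisfies `T = 1 + T²` on `u`. -/
theorem step_first (hf : AdditiveOnKer (expSum m) f) (hm : 2 ≤ m) (g : BraidGroup (m + 1)) :
    f (g * (sigma m 0 * (sigma m 1 * (sigma m 0)⁻¹) * (sigma m 0)⁻¹) * g⁻¹) =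
      f (g * (sigma m 1 * (sigma m 0)⁻¹) * g⁻¹) +
      f (g * (sigma m 0 * sigma m 0 * (sigma m 1 * (sigma m 0)⁻¹) * (sigma m 0 * sigma m 0)⁻¹)
        * g⁻¹) := by
  have hu : expSum m (sigma m 1 * (sigma m 0)⁻¹) = 1 := by
    rw [map_mul, _root_.map_inv, expSum_sigma (by omega), expSum_sigma (by omega), mul_inv_cancel]
  have h1 := hf.conj g _ (sigma m 0 * sigma m 0 * (sigma m 1 * (sigma m 0)⁻¹) *
    (sigma m 0 * sigma m 0)⁻¹) hu (by rw [map_mul, map_mul _ _ (sigma m 1 * _), hu]; simp)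
  simp only at h1
  rw [← h1]
  congr 3
  have hb := (sigma_isBraidSeq m).braid 0 (by omega)
  simp only [Nat.zero_add] at hb
  have e1 : sigma m 0 * (sigma m 1 * (sigma m 0)⁻¹) * (sigma m 0)⁻¹ =
    sigma m 0 * sigma m 1 * sigma m 0 * (sigma m 0 * sigma m 0 * sigma m 0)⁻¹ := by group
  rw [e1, hb]; group

/-- The recursion of `step_first` propagates the two zeros to all `t ^ k u t ^ (-k)`. Conjugates of
`u` depend, under `f`, only on the exponent sum of the conjugator, and the conjugates of `u`
generate the kernel. -/
theorem eq_zero_of_expSum (hf : AdditiveOnKer (expSum m) f) (hm : 2 ≤ m)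
    (h0 : f (sigma m 1 * (sigma m 0)⁻¹) = 0)
    (h1 : f (sigma m 0 * (sigma m 1 * (sigma m 0)⁻¹) * (sigma m 0)⁻¹) = 0)
    {x : BraidGroup (m + 1)} (hx : expSum m x = 1) : f x = 0 := by
  set t := sigma m 0 with ht
  set u := sigma m 1 * t⁻¹ with hu
  have het : expSum m t = Multiplicative.ofAdd 1 := expSum_sigma (by omega)
  have heu : expSum m u = 1 := by
    rw [hu, map_mul, _root_.map_inv, expSum_sigma (by omega), het, mul_inv_cancel]
  have hrec : ∀ k : ℤ, f (t ^ (k + 1) * u * (t ^ (k + 1))⁻¹) =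
      f (t ^ k * u * (t ^ k)⁻¹) + f (t ^ (k + 2) * u * (t ^ (k + 2))⁻¹) := by
    intro k
    have := hf.step_first hm (t ^ k)
    rw [show t ^ (k + 1) * u * (t ^ (k + 1))⁻¹ = t ^ k * (t * u * t⁻¹) * (t ^ k)⁻¹ by group,
      show t ^ (k + 2) * u * (t ^ (k + 2))⁻¹ = t ^ k * (t * t * u * (t * t)⁻¹) * (t ^ k)⁻¹ by
        group]
    exact this
  have hzero : ∀ k : ℤ, f (t ^ k * u * (t ^ k)⁻¹) = 0 ∧
      f (t ^ (k + 1) * u * (t ^ (k + 1))⁻¹) = 0 := by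
    intro k
    induction k using Int.induction_on with
    | zero => exact ⟨by simpa using h0, by simpa using h1⟩
    | succ k ih =>
      refine ⟨ih.2, ?_⟩
      have := hrec k
      rw [ih.1, ih.2] at this
      rw [add_assoc]
      simpa using this.symm
    | pred k ih =>
      have := hrec (-k - 1)
      rw [show -(k : ℤ) - 1 + 1 = -k by ring, show -(k : ℤ) - 1 + 2 = -k + 1 by ring, ih.1,
        ih.2] at this
      rw [show -(k : ℤ) - 1 + 1 = -k by ring]
      exact ⟨by simpa using this.symm, ih.1⟩
  have hconj : ∀ g, f (g * u * g⁻¹) = 0 := by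
    intro g
    rw [hf.conj_eq_of_expSum_eq (h := t ^ Multiplicative.toAdd (expSum m g)) ?_ heu]
    · exact (hzero _).1
    · rw [map_zpow, het, ← ofAdd_zsmul]; simp
  have hall : ∀ i, i + 1 < m → ∀ g, f (g * (sigma m (i + 1) * (sigma m i)⁻¹) * g⁻¹) = 0 := by
    intro i
    induction i with
    | zero => exact fun _ => hconj
    | succ i ih =>
      intro hi g
      have hs := sigma_isBraidSeq m
      have b1 := hs.braid i (by omega)
      have b2 := hs.braid (i + 1) (by omega)
      have b3 := hs.comm i (i + 2) le_rfl (by omega)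
      -- Conjugation by `a * b * c` shifts indices, taking `b * a⁻¹` to `c * b⁻¹`.
      have := ih (by omega) (g * (sigma m i * sigma m (i + 1) * sigma m (i + 2)))
      rw [← this]
      congr 1
      set a := sigma m i
      set b := sigma m (i + 1)
      set c := sigma m (i + 2)
      have e1 : (a * b * c) * b = c * (a * b * c) := by
        calc a * b * c * b = a * (b * c * b) := by group
          _ = (a * c) * b * c := by rw [b2]; group
          _ = _ := by rw [b3]; group
      have e2 : (a * b * c) * a = b * (a * b * c) := by
        calc a * b * c * a = a * b * (a * c) := by rw [b3]; group
          _ = (a * b * a) * c := by group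
          _ = _ := by rw [b1]; group
      have e3 : c * b⁻¹ = (a * b * c) * (b * a⁻¹) * (a * b * c)⁻¹ := by
        have e4 : (a * b * c) * (b * a⁻¹) * (a * b * c)⁻¹ =
          ((a * b * c) * b) * ((a * b * c) * a)⁻¹ := by group
        rw [e4, e1, e2]; group
      change g * (c * b⁻¹) * g⁻¹ = _
      rw [e3]; group
  let S : Subgroup (BraidGroup (m + 1)) :=
    { carrier := {x | expSum m x = 1 ∧ ∀ g, f (g * x * g⁻¹) = 0}
      one_mem' := ⟨_root_.map_one _, fun g => by simp [hf.map_one]⟩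
      mul_mem' := fun {x y} hx hy => ⟨by rw [map_mul, hx.1, hy.1, one_mul], fun g => by
        have h1 := hf.conj g x y hx.1 hy.1
        simp only at h1
        rw [h1, hx.2, hy.2, add_zero]⟩
      inv_mem' := fun {x} hx => ⟨by rw [_root_.map_inv, hx.1, inv_one], fun g => by
        have h1 := (hf.conj g).map_inv hx.1
        rw [h1, hx.2, neg_zero]⟩ }
  have hS : S.Normal := ⟨fun x hx g => ⟨by simp [hx.1], fun g' => by
    have := hx.2 (g' * g)
    simpa [mul_assoc] using this⟩⟩
  have hmk : ∀ i < m, QuotientGroup.mk' S (sigma m i) = QuotientGroup.mk' S t := by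
    intro i hi
    induction i with
    | zero => rfl
    | succ i ih =>
      rw [← ih (by omega), ← mul_inv_eq_one, ← _root_.map_inv, ← map_mul]
      refine (QuotientGroup.eq_one_iff (N := S) _).2 ⟨?_, hall i hi⟩
      rw [map_mul, _root_.map_inv, expSum_sigma hi, expSum_sigma (by omega), mul_inv_cancel]
  have heq : QuotientGroup.mk' S =
      (zpowersHom (BraidGroup (m + 1) ⧸ S) (QuotientGroup.mk' S t)).comp (expSum m) := by
    refine braidHom_ext fun i hi => ?_
    rw [hmk i hi, MonoidHom.comp_apply, expSum_sigma hi]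
    simp
  have hxS : QuotientGroup.mk' S x = 1 := by
    rw [heq, MonoidHom.comp_apply, hx, _root_.map_one]
  have hxS' : x ∈ S := (QuotientGroup.eq_one_iff x).1 hxS
  simpa using hxS'.2 1

end AdditiveOnKer

/-- For three or four strings there is an integral additive function on the kernel of the exponent
sum which is nonzero. -/
theorem exists_additive_expSum (hm : m = 2 ∨ m = 3) : ∃ f : BraidGroup (m + 1) → ℚ,
    AdditiveOnKer (expSum m) f ∧ (∀ x, ∃ k : ℤ, (k : ℚ) = f x) ∧
    f (sigma m 1 * (sigma m 0)⁻¹) = 1 ∧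
    f (sigma m 0 * (sigma m 1 * (sigma m 0)⁻¹) * (sigma m 0)⁻¹) = 0 := by
  -- An integral automorphism of the plane with `T² - T + 1 = 0`, as `step_first` dictates.
  let T : MulAut (Multiplicative (ℤ × ℤ)) := AddEquiv.toMultiplicative
    { toFun := fun v => (-v.2, v.1 + v.2)
      invFun := fun v => (v.1 + v.2, -v.1)
      left_inv := fun v => by ext <;> simp
      right_inv := fun v => by ext <;> simp
      map_add' := fun v w => by ext <;> simp <;> ring }
  let act : Multiplicative ℤ →* MulAut (Multiplicative (ℤ × ℤ)) := zpowersHom _ T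
  have hact1 : act (Multiplicative.ofAdd 1) = T := by simp [act]
  -- The terms `0` and `2` have the same image, so four strings factor through three.
  let s : ℕ → Multiplicative (ℤ × ℤ) ⋊[act] Multiplicative ℤ := fun i =>
    ⟨if i = 1 then Multiplicative.ofAdd (1, 0) else 1, Multiplicative.ofAdd 1⟩
  have hs : IsBraidSeq m s := by
    constructor
    · intro i hi
      have h : i = 0 ∨ i = 1 := by omega
      refine SemidirectProduct.ext ?_ rfl
      simp only [SemidirectProduct.mul_left, SemidirectProduct.mul_right, map_mul, s, hact1]
      rcases h with rfl | rfl <;> rfl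
    · intro i j hij hj
      obtain rfl : i = 0 := by omega
      obtain rfl : j = 2 := by omega
      rfl
  obtain ⟨F, hF⟩ := exists_braidLift hs
  have hr : SemidirectProduct.rightHom.comp F = expSum m := braidHom_ext fun i hi => by
    rw [expSum_sigma hi, MonoidHom.comp_apply, hF i hi]; rfl
  have hu : (F (sigma m 1 * (sigma m 0)⁻¹)).left = Multiplicative.ofAdd (1, 0) := by
    rw [map_mul, map_inv, hF 0 (by omega), hF 1 (by omega)]
    simp [s]
  refine ⟨fun x => ((Multiplicative.toAdd (F x).left).1 : ℤ), ?_, fun x => ⟨_, rfl⟩, ?_, ?_⟩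
  · intro x y hx hy
    rw [← hr] at hx
    have hx' : (F x).right = 1 := hx
    simp only [map_mul, SemidirectProduct.mul_left, hx', map_one, MulAut.one_apply, toAdd_mul,
      Prod.fst_add]
    push_cast; rfl
  · simp only [hu]; simp
  · have : (F (sigma m 0 * (sigma m 1 * (sigma m 0)⁻¹) * (sigma m 0)⁻¹)).left =
        Multiplicative.ofAdd (0, 1) := by
      rw [map_mul, map_mul, SemidirectProduct.mul_left, SemidirectProduct.mul_left, hu, map_inv,
        hF 0 (by omega)]
      simp [s, hact1]
      rfl
    simp only [this]; simp

theorem reidemeisterNumber_braid_three_four (hm : m = 2 ∨ m = 3)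
    (φ : BraidGroup (m + 1) ≃* BraidGroup (m + 1)) : reidemeisterNumber φ = ⊤ := by
  rcases expSum_aut (by omega) φ with hφ | hφ
  · exact reidemeisterNumber_of_expSum_eq (by omega) φ hφ
  have hφ' : ∀ x, expSum m (φ.symm x) = (expSum m x)⁻¹ := fun x => by
    have := hφ (φ.symm x)
    rw [MulEquiv.apply_symm_apply] at this
    rw [this, inv_inv]
  obtain ⟨f, hf, hfZ, hfu, hftu⟩ := exists_additive_expSum hm
  set t := sigma m 0 with ht
  set u := sigma m 1 * t⁻¹ with hu
  have het : expSum m t = Multiplicative.ofAdd 1 := expSum_sigma (by omega)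
  have heu : expSum m u = 1 := by
    rw [hu, map_mul, map_inv, expSum_sigma (by omega), het, mul_inv_cancel]
  have hec : ∀ {x} g, expSum m x = 1 → expSum m (g * x * g⁻¹) = 1 := fun g hx => by simp [hx]
  have hext : ∀ {h h' : BraidGroup (m + 1) → ℚ}, AdditiveOnKer (expSum m) h →
      AdditiveOnKer (expSum m) h' → h u = h' u → h (t * u * t⁻¹) = h' (t * u * t⁻¹) →
      ∀ x, expSum m x = 1 → h x = h' x := by
    intro h h' hh hh' e0 e1 x hx
    have := (hh.add hh' 1 (-1)).eq_zero_of_expSum (by omega) (by rw [← ht, ← hu, e0]; ring)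
      (by rw [← ht, ← hu, e1]; ring) hx
    linarith
  have hstep := hf.step_first (by omega : 2 ≤ m)
  rw [← ht, ← hu] at hstep
  have hf2 : f (t * (t * u * t⁻¹) * t⁻¹) = -1 := by
    have := hstep 1
    simp only [one_mul, inv_one, mul_one, hfu, hftu] at this
    rw [show t * (t * u * t⁻¹) * t⁻¹ = t * t * u * (t * t)⁻¹ by group]
    linarith
  have hquad : ∀ x, expSum m x = 1 → f (t⁻¹ * x * t⁻¹⁻¹) = f x - f (t * x * t⁻¹) := by
    intro x hx
    have := hext (hf.conj t⁻¹) (hf.add (hf.conj t) 1 (-1)) ?_ ?_ x hx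
    · rw [this]; ring
    · have := hstep t⁻¹
      rw [show t⁻¹ * (t * u * t⁻¹) * t⁻¹⁻¹ = u by group,
        show t⁻¹ * (t * t * u * (t * t)⁻¹) * t⁻¹⁻¹ = t * u * t⁻¹ by group] at this
      linarith
    · simp only [hf2, hftu]
      rw [show t⁻¹ * (t * u * t⁻¹) * t⁻¹⁻¹ = u by group, hfu]
      norm_num
  -- In the basis `f`, `f (t * · * t⁻¹)`, an automorphism inverting the exponent sum carries
  -- conjugation by `t` to conjugation by an element of exponent `-1`. This with `hquad` determines
  -- the second row of its matrix from the first.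
  have key : ∀ ψ : BraidGroup (m + 1) ≃* BraidGroup (m + 1),
      (∀ x, expSum m (ψ x) = (expSum m x)⁻¹) → ∃ a b : ℤ, ∀ x, expSum m x = 1 →
      f (ψ x) = a * f x + b * f (t * x * t⁻¹) ∧
      f (t * ψ x * t⁻¹) = (a + b) * f x - a * f (t * x * t⁻¹) := by
    intro ψ hψ
    have hψ1 : ∀ x, expSum m x = 1 → expSum m (ψ x) = 1 := fun x hx => by rw [hψ, hx, inv_one]
    obtain ⟨a, ha⟩ := hfZ (ψ u)
    obtain ⟨b, hb⟩ := hfZ (ψ (t * u * t⁻¹))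
    have h1 : ∀ x, expSum m x = 1 → f (ψ x) = a * f x + (-b : ℤ) * f (t * x * t⁻¹) := by
      refine hext (hf.comp_hom ψ.toMonoidHom hψ1) (hf.add (hf.conj t) _ _) ?_ ?_
      · rw [hfu, hftu, ha]; simp
      · rw [hftu, hf2]; push_cast; rw [hb]; simp
    refine ⟨a, -b, fun x hx => ⟨h1 x hx, ?_⟩⟩
    obtain ⟨w, hw⟩ := ψ.surjective t
    have hew : expSum m w = expSum m t⁻¹ := by
      have := hψ w
      rw [hw] at this
      rw [map_inv, this, inv_inv]
    have e : t * ψ x * t⁻¹ = ψ (w * x * w⁻¹) := by rw [map_mul, map_mul, map_inv, hw]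
    rw [e, h1 _ (hec w hx), hf.conj_eq_of_expSum_eq hew hx, hquad x hx,
      show t * (w * x * w⁻¹) * t⁻¹ = (t * w) * x * (t * w)⁻¹ by group,
      hf.conj_eq_of_expSum_eq (g := t * w) (h := 1) (by rw [map_mul, hew, ← map_mul, mul_inv_cancel]) hx]
    simp only [one_mul, inv_one, mul_one]
    ring
  obtain ⟨a, b, hab⟩ := key φ hφ
  obtain ⟨a', b', hab'⟩ := key φ.symm hφ'
  have hφ1 : ∀ x, expSum m x = 1 → expSum m (φ x) = 1 := fun x hx => by rw [hφ, hx, inv_one]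
  have hφ1' : ∀ x, expSum m x = 1 → expSum m (φ.symm x) = 1 := fun x hx => by
    rw [hφ', hx, inv_one]
  have hcomp : ∀ x, expSum m x = 1 → f x = (a * a' + b * a' + b * b') * f x +
      (a * b' - b * a') * f (t * x * t⁻¹) := by
    intro x hx
    have h1 := (hab _ (hφ1' x hx)).1
    rw [MulEquiv.apply_symm_apply, (hab' x hx).1, (hab' x hx).2] at h1
    linarith
  have h1 := hcomp u heu
  have h2 := hcomp _ (hec t heu)
  rw [hfu, hftu] at h1
  rw [hftu, hf2] at h2
  have h1' : a * a' + b * a' + b * b' = 1 := by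
    have : ((a * a' + b * a' + b * b' : ℤ) : ℚ) = 1 := by push_cast; linarith
    exact_mod_cast this
  have h2' : a * b' - b * a' = 0 := by
    have : ((a * b' - b * a' : ℤ) : ℚ) = 0 := by push_cast; linarith
    exact_mod_cast this
  -- Multiplicativity of the norm form of the Eisenstein integers.
  have hN : (a ^ 2 + a * b + b ^ 2) * (a' ^ 2 + a' * b' + b' ^ 2) = 1 := by
    calc _ = (a * a' + b * a' + b * b') ^ 2 + (a * a' + b * a' + b * b') * (a * b' - b * a') +
          (a * b' - b * a') ^ 2 := by ring
      _ = 1 := by rw [h1', h2']; ring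
  have hnorm : a ^ 2 + a * b + b ^ 2 = 1 := by
    rcases Int.eq_one_or_neg_one_of_mul_eq_one hN with h | h
    · exact h
    · nlinarith [sq_nonneg (a + b), sq_nonneg a, sq_nonneg b]
  have hnormQ : (a : ℚ) ^ 2 + a * b + b ^ 2 = 1 := by exact_mod_cast hnorm
  -- Since `φ` inverts the exponent sum, that of `g * (φ g)⁻¹` is twice that of `g`; only the
  -- trivial coset remains.
  have hfin : {q | ∃ g, expSum m g = q ∧ expSum m (g * 1 * (φ g)⁻¹) = expSum m 1}.Finite := by
    refine (Set.finite_singleton 1).subset ?_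
    rintro _ ⟨g, rfl, hg⟩
    rw [mul_one, map_mul, map_inv, hφ, inv_inv, map_one, ← ofAdd_toAdd (expSum m g),
      ← ofAdd_add] at hg
    have : Multiplicative.toAdd (expSum m g) + Multiplicative.toAdd (expSum m g) = 0 :=
      Multiplicative.ofAdd.injective hg
    rw [Set.mem_singleton_iff, ← ofAdd_toAdd (expSum m g),
      show Multiplicative.toAdd (expSum m g) = 0 by omega]
    rfl
  have final : ∀ c d : ℚ, c * a + d * (a + b) = c → c * b - d * a = d → (c ≠ 0 ∨ d ≠ 0) →
      reidemeisterNumber φ = ⊤ := by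
    intro c d h3 h4 h5
    have hinv : ∀ x, expSum m x = 1 → c * f (1 * φ x * 1⁻¹) + d * f (t * (1 * φ x * 1⁻¹) * t⁻¹) =
        c * f x + d * f (t * x * t⁻¹) := by
      intro x hx
      simp only [one_mul, inv_one, mul_one]
      rw [(hab x hx).1, (hab x hx).2]
      linear_combination f x * h3 + f (t * x * t⁻¹) * h4
    rcases h5 with h5 | h5
    · exact reidemeisterNumber_eq_top (expSum m) φ hφ1 1 hfin (hf.add (hf.conj t) c d) hinv heu
        (by rw [hfu, hftu]; simpa using h5)
    · exact reidemeisterNumber_eq_top (expSum m) φ hφ1 1 hfin (hf.add (hf.conj t) c d) hinv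
        (hec t heu) (by rw [hftu, hf2]; simpa using h5)
  -- The matrix with rows `(a, b)` and `(a + b, -a)` squares to one, so the rows of that matrix plus
  -- the identity are fixed; the second is used when the first vanishes.
  by_cases hz : (1 + (a : ℚ)) = 0 ∧ (b : ℚ) = 0
  · refine final (a + b) (1 - a) ?_ ?_ ?_
    · ring
    · linear_combination hnormQ
    · right; linarith [hz.1]
  · refine final (1 + a) b ?_ ?_ ?_
    · linear_combination hnormQ
    · ring
    · by_cases h : (1 + (a : ℚ)) = 0
      · exact Or.inr fun h' => hz ⟨h, h'⟩
      · exact Or.inl h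

end

/-! ### At most two strings. -/

theorem exists_generator_braidGroup {n : ℕ} (hn : n ≤ 2) :
    ∃ s : BraidGroup n, ∀ x, x ∈ Subgroup.zpowers s := by
  by_cases h : 0 < n - 1
  · refine ⟨PresentedGroup.of ⟨0, h⟩, PresentedGroup.generated_by _ _ fun j => ?_⟩
    obtain rfl : j = ⟨0, h⟩ := Fin.ext (by have := j.2; simp only; omega)
    exact Subgroup.mem_zpowers _
  · exact ⟨1, PresentedGroup.generated_by _ _ fun j => absurd j.2 (by omega)⟩

/-- Inversion on a cyclic group has at most two Reidemeister classes. -/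
theorem not_hasRInfinity_of_cyclic {G : Type*} [Group G] {s : G}
    (hs : ∀ x, x ∈ Subgroup.zpowers s) : ¬ HasRInfinity G := by
  have hcomm : ∀ x y : G, x * y = y * x := by
    intro x y
    obtain ⟨a, rfl⟩ := hs x
    obtain ⟨b, rfl⟩ := hs y
    exact (Commute.refl s).zpow_zpow a b
  let φ : G ≃* G :=
    { toFun := fun x => x⁻¹, invFun := fun x => x⁻¹, left_inv := inv_inv, right_inv := inv_inv
      map_mul' := fun x y => by rw [mul_inv_rev, hcomm] }
  intro h
  have h1 := h φ
  rw [reidemeisterNumber, ENat.card_eq_top] at h1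
  refine not_finite_iff_infinite.2 h1 (Finite.of_surjective
    (fun b : Bool => Quotient.mk (twistedConj φ) (if b then s else 1)) fun c => ?_)
  induction c using Quotient.inductionOn with
  | _ x =>
    obtain ⟨k, rfl⟩ := hs x
    -- For inversion on an abelian group, twisted conjugation by `g` multiplies by `g²`, so only the
    -- parity of the exponent matters.
    obtain ⟨l, rfl | rfl⟩ := Int.even_or_odd' k
    · refine ⟨false, Quotient.sound (s := twistedConj φ) ⟨s ^ l, ?_⟩⟩
      change s ^ (2 * l) = s ^ l * 1 * ((s ^ l)⁻¹)⁻¹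
      rw [mul_one, inv_inv, ← zpow_add, two_mul]
    · refine ⟨true, Quotient.sound (s := twistedConj φ) ⟨s ^ l, ?_⟩⟩
      change s ^ (2 * l + 1) = s ^ l * s * ((s ^ l)⁻¹)⁻¹
      rw [inv_inv]; group

theorem theorem5p3 (n : ℕ) : HasRInfinity (BraidGroup n) ↔ 2 < n := by
  constructor
  · intro h
    by_contra hn
    obtain ⟨s, hs⟩ := exists_generator_braidGroup (not_lt.1 hn)
    exact not_hasRInfinity_of_cyclic hs h
  · intro hn φ
    obtain ⟨m, rfl⟩ : ∃ m, n = m + 1 := ⟨n - 1, by omega⟩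
    by_cases hm : 4 ≤ m
    · exact reidemeisterNumber_braid_of_four_le hm φ
    · exact reidemeisterNumber_braid_three_four (by omega) φ
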